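/- Let $V$ be a finite dimensional real vector space with a $\mathbb{Q}$-structure $V(\mathbb{Q})\subset V$, that is, a $\mathbb{Q}$-subspace for which the natural map $\mathbb{R}\otimes_{\mathbb{Q}}V(\mathbb{Q})\to V$ is an isomorphism. Let $C\subset V$ be an open convex cone (nonempty and invariant under multiplication by positive scalars) which is nondegenerate, i.e. contains no affine line, and let $C_+$ be the convex hull of $\overline{C}\cap V(\mathbb{Q})$. Let $\Gamma\subset \mathrm{GL}(V)$ be a subgroup which leaves $C$ invariant and leaves invariant some lattice of $V$ contained in $V(\mathbb{Q})$. A face of $C_+$ is a nonempty convex subset $F\subset C_+$ such that every segment in $C_+$ with an interior point in $F$ has both its end points in $F$; $\dot X$ denotes the relative interior of a convex set $X$; a polyhedral cone is a cone that is defined by finitely many affine-linear inequalities (it need not be rational); and $Z_\Gamma(F)$ is the group of $\gamma\in\Gamma$ which fix every point of $F$. Let $\Pi_1,\Pi_2\subset C_+$ be polyhedral cones, and let $F_i$ be the face of $C_+$ whose relative interior contains $\dot\Pi_i$ ($i=1,2$; this face exists and is unique). Then: (1) the collection of sets $\{\gamma\Pi_1\cap\Pi_2 \mid \gamma\in\Gamma\}$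 is finite; (2) the set $\{\gamma\in\Gamma \mid \gamma\dot\Pi_1\cap\dot\Pi_2\neq\emptyset\}$ is a finite union of cosets $\gamma_j Z_\Gamma(F_1)$, and it is also a finite union of cosets $Z_\Gamma(F_2)\gamma'_j$, with $\gamma_j,\gamma'_j\in\Gamma$. Moreover, $\Gamma$ acts properly discontinuously on $C$: for all compact sets $K_1,K_2\subset C$, the set of $\gamma\in\Gamma$ with $\gamma K_1\cap K_2\neq\emptyset$ is finite. -/

import Mathlib

open scoped Pointwise

namespace LatticeCone

variable {V : Type*} [NormedAddCommGroup V] [NormedSpace ℝ V]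

/-- A cone: a nonempty subset invariant under multiplication by positive scalars
(it need not contain the origin). -/
def IsCone (K : Set V) : Prop :=
  K.Nonempty ∧ ∀ t : ℝ, 0 < t → ∀ x ∈ K, t • x ∈ K

/-- A set is nondegenerate if it contains no affine line. -/
def IsNondegenerate (X : Set V) : Prop :=
  ∀ x v : V, v ≠ 0 → ¬ ∀ t : ℝ, x + t • v ∈ X

/-- A polyhedron: the solution set of finitely many affine-linear inequalities
`c ≤ φ x`, with `φ` a linear form and `c` a real number. -/
def IsPolyhedron (P : Set V) : Prop :=
  ∃ s : Finset ((V →ₗ[ℝ] ℝ) × ℝ), P = {x | ∀ p ∈ s, p.2 ≤ p.1 x}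

/-- A polyhedral cone: a cone that is a polyhedron. -/
def IsPolyhedralCone (K : Set V) : Prop :=
  IsCone K ∧ IsPolyhedron K

/-- A face of a convex set `X`: a nonempty convex subset `F` of `X` such that a segment in `X`
having a point of `F` in its (relative) interior has its end points in `F`. -/
def IsFace (X F : Set V) : Prop :=
  F.Nonempty ∧ Convex ℝ F ∧ IsExtreme ℝ X F

/-- `F` is a face of `X` whose relative interior contains the relative interior of `K`. -/
def IsCarrierFace (X K F : Set V) : Prop :=
  IsFace X F ∧ intrinsicInterior ℝ K ⊆ intrinsicInterior ℝ F

/-- A `ℚ`-structure on the real vector space `V`: a `ℚ`-subspace `VQ` such that the natural map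
`ℝ ⊗ VQ → V` is an isomorphism. -/
def IsRationalStructure [Module ℚ V] [IsScalarTower ℚ ℝ V] (VQ : Submodule ℚ V) : Prop :=
  IsBaseChange ℝ VQ.subtype

/-- A lattice compatible with the rational structure `VQ`: a discrete subgroup of `V` that spans
`V` over `ℝ` and consists of rational vectors. -/
def IsRationalLattice [Module ℚ V] (VQ : Submodule ℚ V) (L : Submodule ℤ V) : Prop :=
  (∃ _ : DiscreteTopology L, IsZLattice ℝ L) ∧ (L : Set V) ⊆ VQ

/-- `C₊`: the convex hull of the set of rational points of the closure of `C`. -/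
def rationalHull [Module ℚ V] (VQ : Submodule ℚ V) (C : Set V) : Set V :=
  convexHull ℝ (closure C ∩ VQ)

/-- The group `Γ`, which is supposed to preserve `C`, acts properly discontinuously on `C`: for
compact `K₁, K₂ ⊆ C` only finitely many `γ ∈ Γ` satisfy `γ K₁ ∩ K₂ ≠ ∅`. -/
def ActsProperlyDiscontinuouslyOn (Γ : Subgroup (V ≃ₗ[ℝ] V)) (C : Set V) : Prop :=
  ∀ K₁ K₂ : Set V, K₁ ⊆ C → K₂ ⊆ C → IsCompact K₁ → IsCompact K₂ →
    {γ : Γ | (γ • K₁ ∩ K₂).Nonempty}.Finite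

end LatticeCone

/-! Let `A` be the set of lattice points of a face of `C₊`, or of the closure of `C` for proper
discontinuity. Nondegeneracy of `C` provides linear forms with natural values on `A` and finite
sublevel sets there (`properForms`). At a relatively interior point `x` only finitely many of them
have value below a given bound, so some form is minimal at `x`, and minimality is equivariant: if `g
'' A = A'` and `η` is minimal at `g x`, then `η ∘ g` is minimal at `x`. A given pair `(η, η ∘ g)`
leaves finitely many possibilities for `g` on the span of `A` (`finite_transporter`).

It remains to see that finitely many forms are minimal somewhere on the sets considered. For a cone
generated by finitely many elements of `A` this is Dickson's lemma
(`finite_minimizers_of_mem_cone`); for a compact subset of `C` it follows by comparison with one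
fixed form. A polyhedral cone in `C₊`, rational or not, lies in such a finitely generated cone,
because its carrier face is generated by lattice points. If `γ` makes the relative interiors meet,
it maps `F₁` onto `F₂`, and only its restriction to the span of `F₁` is controlled: hence cosets of
the pointwise stabilizer.

For (1), each `γ Π₁ ∩ Π₂` is also an intersection of faces whose relative interiors meet, and there
are finitely many pairs of faces. -/

namespace LatticeCone

/-! ### Faces and relative interiors via prolongation of segments -/

section Faces

open AffineMap Set

variable {V : Type*} [NormedAddCommGroup V] [NormedSpace ℝ V]

/-- The set of points `y` of `X` for which the segment from `y` to `x` can be prolonged in `X`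
beyond `x`; for convex `X` this is the smallest face of `X` that contains `x`. -/
def minFace (X : Set V) (x : V) : Set V :=
  {y | y ∈ X ∧ ∃ ε : ℝ, 0 < ε ∧ x + ε • (x - y) ∈ X}

theorem exists_prolong_of_mem_intrinsicInterior {X : Set V} {x y : V}
    (hx : x ∈ intrinsicInterior ℝ X) (hy : y ∈ X) :
    ∃ ε : ℝ, 0 < ε ∧ x + ε • (x - y) ∈ X := by
  obtain ⟨x', hx', rfl⟩ := mem_intrinsicInterior.1 hx
  have : Nonempty (affineSpan ℝ X) := ⟨x'⟩
  let y' : affineSpan ℝ X := ⟨y, subset_affineSpan ℝ X hy⟩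
  have hcont : Continuous fun t : ℝ => lineMap (k := ℝ) x' y' (-t) := by
    have : Continuous fun t : ℝ => (((lineMap (k := ℝ) x' y' (-t) : affineSpan ℝ X)) : V) := by
      have h (t : ℝ) : (((lineMap (k := ℝ) x' y' (-t) : affineSpan ℝ X)) : V) =
          (x' : V) + (-t) • (y - x') := by
        rw [AffineMap.lineMap_apply]
        simp [y', add_comm]
      simp only [h]
      fun_prop
    exact continuous_induced_rng.2 this
  have h0 : lineMap (k := ℝ) x' y' (-(0 : ℝ)) ∈ interior ((↑) ⁻¹' X : Set (affineSpan ℝ X)) := by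
    simpa using hx'
  have hnear := hcont.continuousAt.preimage_mem_nhds (isOpen_interior.mem_nhds h0)
  obtain ⟨δ, hδ, hball⟩ := Metric.mem_nhds_iff.1 hnear
  refine ⟨δ / 2, by positivity, ?_⟩
  have hmem : δ / 2 ∈ Metric.ball (0 : ℝ) δ := by
    simp [abs_of_pos hδ]
    linarith [abs_of_pos hδ]
  have := interior_subset (hball hmem)
  simp only [mem_preimage, AffineMap.lineMap_apply] at this
  convert this using 1
  simp only [y', AffineSubspace.coe_vadd, Submodule.coe_smul, AffineSubspace.coe_vsub, vsub_eq_sub,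
    vadd_eq_add]
  module

/-- Prolong a segment from a relatively interior `z` beyond `x` to `w`. The homothety centred at `w`
that takes `z` to `x` is open and maps `X` into itself by convexity. -/
theorem mem_intrinsicInterior_of_prolong [FiniteDimensional ℝ V] {X : Set V} (hX : Convex ℝ X)
    {x : V} (hx : x ∈ X) (h : ∀ y ∈ X, ∃ ε : ℝ, 0 < ε ∧ x + ε • (x - y) ∈ X) :
    x ∈ intrinsicInterior ℝ X := by
  obtain ⟨z, hz⟩ := Set.Nonempty.intrinsicInterior hX ⟨x, hx⟩
  obtain ⟨z', hz', rfl⟩ := mem_intrinsicInterior.1 hz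
  have : Nonempty (affineSpan ℝ X) := ⟨z'⟩
  obtain ⟨ε, hε, hw⟩ := h z' (intrinsicInterior_subset hz)
  let w : affineSpan ℝ X := ⟨x + ε • (x - z'), subset_affineSpan ℝ X hw⟩
  have hε' : (1 + ε) ≠ 0 := by positivity
  have hval (p : affineSpan ℝ X) : ((homothety w (ε / (1 + ε)) p : affineSpan ℝ X) : V) =
      (ε / (1 + ε)) • (p : V) + (1 / (1 + ε)) • (w : V) := by
    rw [homothety_apply]
    simp only [AffineSubspace.coe_vadd, Submodule.coe_smul, AffineSubspace.coe_vsub, vsub_eq_sub,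
      vadd_eq_add]
    have : (1 / (1 + ε)) = 1 - ε / (1 + ε) := by field_simp; ring
    rw [this]
    module
  have hopen := (homothety_isOpenMap w (ε / (1 + ε)) (by positivity)).image_interior_subset
    ((↑) ⁻¹' X : Set (affineSpan ℝ X))
  have hsub : homothety w (ε / (1 + ε)) '' ((↑) ⁻¹' X : Set (affineSpan ℝ X)) ⊆ (↑) ⁻¹' X := by
    rintro _ ⟨p, hp, rfl⟩
    rw [mem_preimage, hval]
    exact hX hp hw (by positivity) (by positivity) (by field_simp; ring)
  refine mem_intrinsicInterior.2 ⟨homothety w (ε / (1 + ε)) z',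
    interior_mono hsub (hopen ⟨z', hz', rfl⟩), ?_⟩
  rw [hval]
  have h1 : ε / (1 + ε) = ε * (1 / (1 + ε)) := by field_simp
  have h2 : x = ((1 + ε) * (1 / (1 + ε))) • x := by
    rw [mul_one_div_cancel hε', one_smul]
  conv_rhs => rw [h2]
  rw [h1]
  simp only [w]
  module

theorem prolong_mono {X : Set V} (hX : Convex ℝ X) {x y : V} (hx : x ∈ X) {ε δ : ℝ} (hδ : 0 < δ)
    (hδε : δ ≤ ε) (h : x + ε • (x - y) ∈ X) : x + δ • (x - y) ∈ X := by
  have hε : 0 < ε := hδ.trans_le hδε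
  have := hX.add_smul_mem (x := x) (y := ε • (x - y)) hx h (t := δ / ε)
    ⟨by positivity, (div_le_one hε).2 hδε⟩
  rwa [smul_smul, div_mul_cancel₀ _ hε.ne'] at this

theorem mem_minFace_self {X : Set V} {x : V} (hx : x ∈ X) : x ∈ minFace X x :=
  ⟨hx, 1, one_pos, by simpa using hx⟩

theorem isFace_minFace {X : Set V} (hX : Convex ℝ X) {x : V} (hx : x ∈ X) :
    IsFace X (minFace X x) := by
  refine ⟨⟨x, mem_minFace_self hx⟩, ?_, fun y hy => hy.1, ?_⟩
  · rintro y ⟨hy, ε, hε, hyε⟩ z ⟨hz, δ, hδ, hzδ⟩ a b ha hb hab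
    refine ⟨hX hy hz ha hb hab, min ε δ, lt_min hε hδ, ?_⟩
    have h1 := prolong_mono hX hx (lt_min hε hδ) (min_le_left ε δ) hyε
    have h2 := prolong_mono hX hx (lt_min hε hδ) (min_le_right ε δ) hzδ
    convert hX h1 h2 ha hb hab using 1
    obtain rfl : a = 1 - b := by linarith
    module
  · rintro a ha b hb y ⟨hy, ε, hε, hyε⟩ ⟨s, t, hs, ht, hst, rfl⟩
    -- Average the prolongation past `x` with `b`, weighted so that the `b`-terms cancel.
    refine ⟨ha, ε * s / (1 + ε * t), by positivity, ?_⟩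
    convert hX hyε hb (a := 1 / (1 + ε * t)) (b := ε * t / (1 + ε * t)) (by positivity)
      (by positivity) (by field_simp) using 1
    obtain rfl : s = 1 - t := by linarith
    have h1 : ε * (1 - t) / (1 + ε * t) = (ε * (1 - t)) * (1 / (1 + ε * t)) := by field_simp
    have h2 : ε * t / (1 + ε * t) = (ε * t) * (1 / (1 + ε * t)) := by field_simp
    have h3 : x = ((1 + ε * t) * (1 / (1 + ε * t))) • x := by
      rw [mul_one_div_cancel (by positivity), one_smul]
    rw [h1, h2]
    conv_lhs => enter [1]; rw [h3]
    module

theorem minFace_subset_of_isExtreme {X F : Set V} (hF : IsExtreme ℝ X F) {x : V} (hx : x ∈ F) :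
    minFace X x ⊆ F := by
  rintro y ⟨hy, ε, hε, hyε⟩
  refine hF.2 hy hyε hx ⟨ε / (1 + ε), 1 / (1 + ε), by positivity, by positivity,
    by field_simp; ring, ?_⟩
  have h1 : ε / (1 + ε) = ε * (1 / (1 + ε)) := by field_simp
  have h2 : x = ((1 + ε) * (1 / (1 + ε))) • x := by
    rw [mul_one_div_cancel (by positivity), one_smul]
  conv_rhs => rw [h2]
  rw [h1]
  module

theorem mem_intrinsicInterior_minFace [FiniteDimensional ℝ V] {X : Set V} (hX : Convex ℝ X) {x : V}
    (hx : x ∈ X) : x ∈ intrinsicInterior ℝ (minFace X x) := by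
  refine mem_intrinsicInterior_of_prolong (isFace_minFace hX hx).2.1 (mem_minFace_self hx) ?_
  rintro y ⟨hy, ε, hε, hyε⟩
  refine ⟨ε, hε, hyε, 1 / ε, by positivity, ?_⟩
  convert hy using 1
  have : (1 / ε) • (x - (x + ε • (x - y))) = -(x - y) := by
    rw [show x - (x + ε • (x - y)) = ε • (-(x - y)) by module, smul_smul,
      one_div_mul_cancel hε.ne', one_smul]
  rw [this]
  module

theorem eq_minFace {X F : Set V} (hF : IsFace X F) {x : V} (hx : x ∈ intrinsicInterior ℝ F) :
    F = minFace X x := by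
  refine Subset.antisymm (fun y hy => ⟨hF.2.2.1 hy, ?_⟩)
    (minFace_subset_of_isExtreme hF.2.2 (intrinsicInterior_subset hx))
  obtain ⟨ε, hε, h⟩ := exists_prolong_of_mem_intrinsicInterior hx hy
  exact ⟨ε, hε, hF.2.2.1 h⟩

theorem IsCarrierFace.eq_minFace {X K F : Set V} (h : IsCarrierFace X K F) {x : V}
    (hx : x ∈ intrinsicInterior ℝ K) : F = minFace X x :=
  LatticeCone.eq_minFace h.1 (h.2 hx)

theorem isCarrierFace_minFace [FiniteDimensional ℝ V] {X K : Set V} (hX : Convex ℝ X)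
    (hKX : K ⊆ X) {x : V} (hx : x ∈ intrinsicInterior ℝ K) : IsCarrierFace X K (minFace X x) := by
  have hsub {x y : V} (hx : x ∈ intrinsicInterior ℝ K) (hy : y ∈ K) : y ∈ minFace X x := by
    obtain ⟨ε, hε, h⟩ := exists_prolong_of_mem_intrinsicInterior hx hy
    exact ⟨hKX hy, ε, hε, hKX h⟩
  have hxX := hKX (intrinsicInterior_subset hx)
  refine ⟨isFace_minFace hX hxX, fun y hy => ?_⟩
  have hyX := hKX (intrinsicInterior_subset hy)
  have : minFace X x = minFace X y := Subset.antisymm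
    (minFace_subset_of_isExtreme (isFace_minFace hX hyX).2.2
      (hsub hy (intrinsicInterior_subset hx)))
    (minFace_subset_of_isExtreme (isFace_minFace hX hxX).2.2
      (hsub hx (intrinsicInterior_subset hy)))
  rw [this]
  exact mem_intrinsicInterior_minFace hX hyX

theorem existsUnique_isCarrierFace [FiniteDimensional ℝ V] {X K : Set V} (hX : Convex ℝ X)
    (hK : Convex ℝ K) (hne : K.Nonempty) (hKX : K ⊆ X) : ∃! F, IsCarrierFace X K F := by
  obtain ⟨x, hx⟩ := hne.intrinsicInterior hK
  exact ⟨_, isCarrierFace_minFace hX hKX hx, fun F hF => hF.eq_minFace hx⟩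

theorem IsCarrierFace.subset {X K F : Set V} (h : IsCarrierFace X K F) (hKX : K ⊆ X) {x : V}
    (hx : x ∈ intrinsicInterior ℝ K) : K ⊆ F := by
  rw [h.eq_minFace hx]
  intro y hy
  obtain ⟨ε, hε, h⟩ := exists_prolong_of_mem_intrinsicInterior hx hy
  exact ⟨hKX hy, ε, hε, hKX h⟩

theorem image_minFace {W : Type*} [NormedAddCommGroup W] [NormedSpace ℝ W] (γ : V ≃ₗ[ℝ] W)
    (X : Set V) (x : V) : γ '' minFace X x = minFace (γ '' X) (γ x) := by
  ext y
  obtain ⟨y, rfl⟩ := γ.surjective y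
  have h (ε : ℝ) : γ x + ε • (γ x - γ y) = γ (x + ε • (x - y)) := by simp
  simp only [minFace, h, γ.injective.mem_set_image, Set.mem_ofPred_eq]

theorem smul_mem_face {X F : Set V} (hX : ∀ t : ℝ, 0 ≤ t → ∀ x ∈ X, t • x ∈ X)
    (hF : IsFace X F) {t : ℝ} (ht : 0 ≤ t) {x : V} (hx : x ∈ F) : t • x ∈ F := by
  have hxX := hF.2.2.1 hx
  refine minFace_subset_of_isExtreme hF.2.2 hx ⟨hX t ht x hxX, 1 / (1 + t), by positivity, ?_⟩
  convert hX (2 / (1 + t)) (by positivity) x hxX using 1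
  have h1 : (2 : ℝ) / (1 + t) = 1 + 1 / (1 + t) - t / (1 + t) := by field_simp; ring
  have h2 : t / (1 + t) = t * (1 / (1 + t)) := by field_simp
  rw [h1, h2]
  module

/-- The complement of an extreme set in a convex set is convex, so a point of `F` on a segment from
`conv (Z ∩ F)` to `conv (Z \ F)` must be the first end point. -/
theorem face_subset_convexHull {Z F : Set V} (hF : IsExtreme ℝ (convexHull ℝ Z) F) :
    F ⊆ convexHull ℝ (Z ∩ F) := by
  classical
  intro y hy
  have hout : convexHull ℝ (Z \ F) ⊆ convexHull ℝ Z \ F :=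
    convexHull_min (fun z hz => ⟨subset_convexHull ℝ Z hz.1, hz.2⟩)
      (hF.convex_sdiff (convex_convexHull ℝ Z))
  rcases (Z ∩ F).eq_empty_or_nonempty with h1 | h1
  · have : Z \ F = Z := by rw [sdiff_eq_left, disjoint_iff_inter_eq_empty, h1]
    rw [this] at hout
    exact absurd hy (hout (hF.1 hy)).2
  rcases (Z \ F).eq_empty_or_nonempty with h2 | h2
  · rw [inter_eq_left.2 (sdiff_eq_empty.1 h2)]
    exact hF.1 hy
  have hyZ := hF.1 hy
  rw [← inter_union_sdiff Z F, convexHull_union h1 h2] at hyZ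
  obtain ⟨p, hp, q, hq, hpq⟩ := mem_convexJoin.1 hyZ
  have hpZ := convexHull_mono inter_subset_left hp
  have hqZ := hout hq
  rcases eq_or_ne y p with rfl | hyp
  · exact hp
  rcases eq_or_ne y q with rfl | hyq
  · exact absurd hy hqZ.2
  exact absurd (hF.right_mem_of_mem_openSegment hpZ hqZ.1 hy
    (mem_openSegment_of_ne_left_right hyp.symm hyq.symm hpq)) hqZ.2

end Faces

/-! ### Proper integral forms and their minimizers -/

section Forms

open Set

variable {E : Type*} [AddCommGroup E] [Module ℝ E]

/-- The linear forms that take on `A` natural numbers as values, each bounded interval of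
values being attained by finitely many elements only. -/
def properForms (A : Set E) : Set (Module.Dual ℝ E) :=
  {ξ | (∀ a ∈ A, ∃ n : ℕ, ξ a = n) ∧ ∀ c : ℝ, {a | a ∈ A ∧ ξ a ≤ c}.Finite}

/-- The proper forms on `A` that are minimal at `x`. -/
def minimizers (A : Set E) (x : E) : Set (Module.Dual ℝ E) :=
  {ξ | ξ ∈ properForms A ∧ ∀ η ∈ properForms A, ξ x ≤ η x}

/-- `x` dominates small multiples of every element of `A` in the order that is dual to the cone
of linear forms that are nonnegative on `A`. -/
def IsInner (A : Set E) (x : E) : Prop :=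
  ∀ b ∈ A, ∃ ε : ℝ, 0 < ε ∧ ∀ ξ : Module.Dual ℝ E, (∀ a ∈ A, 0 ≤ ξ a) → ε * ξ b ≤ ξ x

theorem properForms_nonneg {A : Set E} {ξ : Module.Dual ℝ E} (hξ : ξ ∈ properForms A) :
    ∀ a ∈ A, 0 ≤ ξ a := by
  intro a ha
  obtain ⟨n, hn⟩ := hξ.1 a ha
  rw [hn]
  positivity

theorem exists_finite_spanning [FiniteDimensional ℝ E] {A : Set E}
    (hA : Submodule.span ℝ A = ⊤) : ∃ B ⊆ A, B.Finite ∧ Submodule.span ℝ B = ⊤ := by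
  obtain ⟨B, hBA, hB, hli⟩ := exists_linearIndependent ℝ A
  exact ⟨B, hBA, hli.setFinite, hB.trans hA⟩

theorem finite_forms_of_bounded [FiniteDimensional ℝ E] {A : Set E}
    (hA : Submodule.span ℝ A = ⊤) (c : E → ℝ) :
    {ξ : Module.Dual ℝ E | (∀ a ∈ A, ∃ n : ℕ, ξ a = n) ∧ ∀ a ∈ A, ξ a ≤ c a}.Finite := by
  obtain ⟨B, hBA, hfin, hB⟩ := exists_finite_spanning hA
  have := hfin.to_subtype
  have hpi : (Set.univ.pi fun b : B => ((↑) : ℕ → ℝ) '' Set.Iic ⌊c b⌋₊).Finite :=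
    Set.Finite.pi fun b => (Set.finite_Iic _).image _
  refine Set.Finite.of_injOn (f := fun ξ (b : B) => ξ b) ?_ ?_ hpi
  · rintro ξ ⟨h1, h2⟩ b -
    obtain ⟨n, hn⟩ := h1 b (hBA b.2)
    refine ⟨n, Nat.le_floor ?_, hn.symm⟩
    rw [← hn]
    exact h2 b (hBA b.2)
  · intro ξ _ η _ h
    refine LinearMap.ext_on hB fun b hb => ?_
    exact congrFun h ⟨b, hb⟩

theorem IsInner.finite_sublevel [FiniteDimensional ℝ E] {A : Set E}
    (hA : Submodule.span ℝ A = ⊤) {x : E} (hx : IsInner A x) (c : ℝ) :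
    {ξ | ξ ∈ properForms A ∧ ξ x ≤ c}.Finite := by
  choose! ε hε h using hx
  refine (finite_forms_of_bounded hA fun b => c / ε b).subset ?_
  rintro ξ ⟨hξ, hc⟩
  refine ⟨hξ.1, fun b hb => ?_⟩
  rw [le_div_iff₀ (hε b hb), mul_comm]
  exact (h b hb ξ (properForms_nonneg hξ)).trans hc

theorem minimizers_nonempty [FiniteDimensional ℝ E] {A : Set E}
    (hA : Submodule.span ℝ A = ⊤) (hD : (properForms A).Nonempty) {x : E} (hx : IsInner A x) :
    (minimizers A x).Nonempty := by
  obtain ⟨ξ₀, h₀⟩ := hD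
  obtain ⟨ξ, ⟨hξ, hξx⟩, hmin⟩ := Set.exists_min_image _ (fun ξ : Module.Dual ℝ E => ξ x)
    (hx.finite_sublevel hA (ξ₀ x)) ⟨ξ₀, h₀, le_rfl⟩
  refine ⟨ξ, hξ, fun η hη => ?_⟩
  rcases le_total (η x) (ξ₀ x) with h | h
  · exact hmin η ⟨hη, h⟩
  · exact hξx.trans h

/-- If `x` has positive coefficients exactly on `S'`, the values on `S'` of a form minimal at `x`
are minimal componentwise among proper forms. Such vectors form an antichain in `ℕ^S'`, finite by
Dickson's lemma. They determine the value at any one inner point of the span of `S'`, which leaves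
finitely many forms. -/
theorem finite_minimizers_of_mem_cone [FiniteDimensional ℝ E] {A : Set E}
    (hA : Submodule.span ℝ A = ⊤) (S : Finset E) (hS : (S : Set E) ⊆ A) :
    {ξ | ∃ x, IsInner A x ∧ (∃ t : E → ℝ, (∀ s, 0 ≤ t s) ∧ ∑ s ∈ S, t s • s = x) ∧
      ξ ∈ minimizers A x}.Finite := by
  classical
  let N : Finset E → Set (Module.Dual ℝ E) := fun S' => {ξ | ξ ∈ properForms A ∧
    (∃ x, IsInner A x ∧ ∃ t : E → ℝ, ∑ s ∈ S', t s • s = x) ∧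
    ∀ η ∈ properForms A, (∀ s ∈ S', η s ≤ ξ s) → ∀ s ∈ S', ξ s ≤ η s}
  have hN : ∀ S' ∈ S.powerset, (N S').Finite := by
    intro S' hS'
    have hSA : ∀ s ∈ S', s ∈ A := fun s hs => hS (Finset.mem_powerset.1 hS' hs)
    by_cases hne : ∃ x, IsInner A x ∧ ∃ t : E → ℝ, ∑ s ∈ S', t s • s = x
    swap
    · convert Set.finite_empty (α := Module.Dual ℝ E)
      ext ξ
      simp only [N, Set.mem_ofPred_eq, Set.mem_empty_iff_false, iff_false]
      exact fun h => hne h.2.1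
    obtain ⟨x, hx, t, rfl⟩ := hne
    let W : Set (S' → ℕ) := {v | ∃ ξ ∈ N S', ∀ s : S', ξ s = v s}
    have hW : W.Finite := by
      refine IsAntichain.finite_of_partiallyWellOrderedOn (r := (· ≤ ·)) ?_
        (Set.isPWO_of_wellQuasiOrderedLE W)
      rintro v ⟨ξ, hξ, hv⟩ w ⟨η, hη, hw⟩ hvw hle
      refine hvw (le_antisymm hle fun s => ?_)
      have := hη.2.2 ξ hξ.1 (fun s hs => ?_) s s.2
      · rw [hv, hw] at this
        exact_mod_cast this
      · rw [hv ⟨s, hs⟩, hw ⟨s, hs⟩]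
        exact_mod_cast hle ⟨s, hs⟩
    refine (hW.biUnion fun (v : S' → ℕ) _ =>
      hx.finite_sublevel hA (∑ s ∈ S'.attach, t s * v s)).subset ?_
    intro ξ hξ
    choose v hv using fun s : S' => hξ.1.1 s (hSA s s.2)
    refine Set.mem_biUnion (x := v) ⟨ξ, hξ, hv⟩ ⟨hξ.1, le_of_eq ?_⟩
    rw [map_sum, ← Finset.sum_attach]
    simp [hv]
  refine (S.powerset.finite_toSet.biUnion hN).subset ?_
  rintro ξ ⟨x, hx, ⟨t, ht, rfl⟩, hξ⟩
  have hsum : ∑ s ∈ S with 0 < t s, t s • s = ∑ s ∈ S, t s • s := by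
    refine Finset.sum_filter_of_ne fun s _ h => lt_of_le_of_ne (ht s) ?_
    rintro h0
    simp [← h0] at h
  refine Set.mem_biUnion (x := S.filter fun s => 0 < t s) 
    (Finset.mem_coe.2 (Finset.mem_powerset.2 (Finset.filter_subset _ _))) ⟨hξ.1, ⟨_, hx, t, hsum⟩, ?_⟩
  intro η hη hle
  have hmin := hξ.2 η hη
  rw [← hsum] at hmin
  simp only [map_sum, map_smul, smul_eq_mul] at hmin
  have hle' : ∀ s ∈ S.filter fun s => 0 < t s, t s * η s ≤ t s * ξ s := fun s hs =>
    mul_le_mul_of_nonneg_left (hle s hs) (ht s)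
  have heq := (Finset.sum_eq_sum_iff_of_le hle').1 (le_antisymm (Finset.sum_le_sum hle') hmin)
  intro s hs
  exact (mul_left_cancel₀ (Finset.mem_filter.1 hs).2.ne' (heq s hs)).ge

variable {E' : Type*} [AddCommGroup E'] [Module ℝ E']

theorem comp_mem_properForms {A : Set E} {A' : Set E'} (g : E ≃ₗ[ℝ] E') (hg : g '' A = A')
    {ξ : Module.Dual ℝ E'} (hξ : ξ ∈ properForms A') :
    ξ ∘ₗ (g : E →ₗ[ℝ] E') ∈ properForms A := by
  subst hg
  refine ⟨fun a ha => hξ.1 _ ⟨a, ha, rfl⟩, fun c => ?_⟩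
  refine Set.Finite.of_injOn (f := g) ?_ g.injective.injOn (hξ.2 c)
  rintro a ⟨ha, hc⟩
  exact ⟨⟨a, ha, rfl⟩, hc⟩

theorem comp_mem_minimizers {A : Set E} {A' : Set E'} (g : E ≃ₗ[ℝ] E') (hg : g '' A = A')
    {x : E} {ξ : Module.Dual ℝ E'} (hξ : ξ ∈ minimizers A' (g x)) :
    ξ ∘ₗ (g : E →ₗ[ℝ] E') ∈ minimizers A x := by
  refine ⟨comp_mem_properForms g hg hξ.1, fun η hη => ?_⟩
  have hg' : g.symm '' A' = A := by
    rw [← hg, ← Set.image_comp]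
    simp
  simpa using hξ.2 _ (comp_mem_properForms g.symm hg' hη)

/-- Each `b` in a finite spanning subset of `A` must go to one of the finitely many `a ∈ A'` with `η
a ≤ ξ b`. -/
theorem finite_transporter [FiniteDimensional ℝ E] {A : Set E} {A' : Set E'}
    (hA : Submodule.span ℝ A = ⊤) (ξ : Module.Dual ℝ E)
    {η : Module.Dual ℝ E'} (hη : η ∈ properForms A') :
    {g : E ≃ₗ[ℝ] E' | g '' A = A' ∧ η ∘ₗ (g : E →ₗ[ℝ] E') = ξ}.Finite := by
  obtain ⟨B, hBA, hfin, hB⟩ := exists_finite_spanning hA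
  have := hfin.to_subtype
  have hpi : (Set.univ.pi fun b : B => {a | a ∈ A' ∧ η a ≤ ξ b}).Finite :=
    Set.Finite.pi fun b => hη.2 _
  refine Set.Finite.of_injOn (f := fun g (b : B) => g b) ?_ ?_ hpi
  · rintro g ⟨h1, rfl⟩ b -
    exact ⟨h1 ▸ ⟨b, hBA b.2, rfl⟩, le_rfl⟩
  · intro g _ h _ hgh
    refine LinearEquiv.toLinearMap_injective (LinearMap.ext_on hB fun b hb => ?_)
    exact congrFun hgh ⟨b, hb⟩

/-- Isomorphisms carrying `A` to `A'` and some point of `X` to a point of `Y` are finite in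
number, if only finitely many forms are minimal at a point of `X` or of `Y`. -/
theorem finite_isomorphisms [FiniteDimensional ℝ E] [FiniteDimensional ℝ E']
    {A : Set E} {A' : Set E'}
    (hA : Submodule.span ℝ A = ⊤) (hA' : Submodule.span ℝ A' = ⊤) (hD : (properForms A').Nonempty)
    {X : Set E} {Y : Set E'} (hY : ∀ y ∈ Y, IsInner A' y)
    (hX_fin : {ξ | ∃ x ∈ X, ξ ∈ minimizers A x}.Finite)
    (hY_fin : {ξ | ∃ y ∈ Y, ξ ∈ minimizers A' y}.Finite) :
    {g : E ≃ₗ[ℝ] E' | g '' A = A' ∧ ∃ x ∈ X, g x ∈ Y}.Finite := by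
  refine (hX_fin.biUnion fun ξ _ => hY_fin.biUnion (t := fun η =>
    {g : E ≃ₗ[ℝ] E' | η ∈ properForms A' ∧ g '' A = A' ∧ η ∘ₗ (g : E →ₗ[ℝ] E') = ξ})
    fun η hη => (finite_transporter hA ξ (η := η) ?_).subset fun g hg => hg.2).subset ?_
  · obtain ⟨y, -, hy⟩ := hη
    exact hy.1
  · rintro g ⟨hg, x, hx, hgx⟩
    obtain ⟨η, hη⟩ := minimizers_nonempty hA' hD (hY _ hgx)
    exact Set.mem_biUnion (x := η ∘ₗ (g : E →ₗ[ℝ] E')) ⟨x, hx, comp_mem_minimizers g hg hη⟩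
      (Set.mem_biUnion (x := η) ⟨_, hgx, hη⟩ ⟨hη.1, hg, rfl⟩)

end Forms

/-! ### Polyhedral cones: faces, generic points, generators -/

section Polyhedral

open Set Filter Topology

variable {V : Type*} [NormedAddCommGroup V] [NormedSpace ℝ V]

/-- The cone cut out by finitely many linear forms. -/
def dualCone (s : Finset (V →ₗ[ℝ] ℝ)) : Set V := {x | ∀ φ ∈ s, 0 ≤ φ x}

theorem IsPolyhedralCone.exists_eq_dualCone {K : Set V} (hK : IsPolyhedralCone K) :
    ∃ s : Finset (V →ₗ[ℝ] ℝ), K = dualCone s := by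
  classical
  obtain ⟨⟨⟨z, hz⟩, hcone⟩, s, rfl⟩ := hK
  refine ⟨s.image Prod.fst, Subset.antisymm ?_ ?_⟩
  · intro x hx φ hφ
    obtain ⟨p, hp, rfl⟩ := Finset.mem_image.1 hφ
    by_contra! hneg
    -- This multiple of `x` has value `-(|c| + 1) < c`.
    have hpos : 0 < (|p.2| + 1) / -(p.1 x) := div_pos (by positivity) (by linarith)
    have := hcone _ hpos x hx p hp
    rw [map_smul, smul_eq_mul, div_mul_eq_mul_div, div_neg, mul_div_assoc, div_self hneg.ne] at this
    linarith [neg_abs_le p.2]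
  · intro x hx p hp
    have hp0 : p.2 ≤ 0 := by
      by_contra! hpos
      have hz' := hz p hp
      have := hcone (p.2 / (2 * p.1 z)) (div_pos hpos (by linarith)) z hz p hp
      rw [map_smul, smul_eq_mul, div_mul_eq_mul_div, mul_comm 2, ← div_div,
        mul_div_assoc, div_self (by linarith)] at this
      linarith
    exact hp0.trans (hx p.1 (Finset.mem_image_of_mem _ hp))

theorem zero_mem_dualCone (s : Finset (V →ₗ[ℝ] ℝ)) : (0 : V) ∈ dualCone s := by
  simp [dualCone]

theorem add_mem_dualCone {s : Finset (V →ₗ[ℝ] ℝ)} {x y : V} (hx : x ∈ dualCone s)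
    (hy : y ∈ dualCone s) : x + y ∈ dualCone s := by
  intro φ hφ
  rw [map_add]
  exact add_nonneg (hx φ hφ) (hy φ hφ)

theorem smul_mem_dualCone {s : Finset (V →ₗ[ℝ] ℝ)} {x : V} (hx : x ∈ dualCone s) {t : ℝ}
    (ht : 0 ≤ t) : t • x ∈ dualCone s := by
  intro φ hφ
  rw [map_smul]
  exact mul_nonneg ht (hx φ hφ)

theorem convex_dualCone (s : Finset (V →ₗ[ℝ] ℝ)) : Convex ℝ (dualCone s) :=
  fun _ hx _ hy _ _ ha hb _ => add_mem_dualCone (smul_mem_dualCone hx ha) (smul_mem_dualCone hy hb)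

theorem isClosed_dualCone [FiniteDimensional ℝ V] (s : Finset (V →ₗ[ℝ] ℝ)) :
    IsClosed (dualCone s) := by
  have : dualCone s = ⋂ φ ∈ s, {x | 0 ≤ φ x} := by
    ext
    simp [dualCone]
  rw [this]
  exact isClosed_biInter fun φ _ => isClosed_le continuous_const φ.continuous_of_finiteDimensional

/-- Forms active at `x` vanish along the whole line; the finitely many others stay positive near
`x`. -/
theorem dualCone_prolong {s : Finset (V →ₗ[ℝ] ℝ)} {x y : V} (hx : x ∈ dualCone s)
    (h : ∀ φ ∈ s, φ x = 0 → φ y = 0) : ∃ ε : ℝ, 0 < ε ∧ x + ε • (x - y) ∈ dualCone s := by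
  have key : ∀ᶠ ε : ℝ in 𝓝[>] 0, ∀ φ ∈ s, 0 ≤ φ (x + ε • (x - y)) := by
    rw [Finset.eventually_all]
    intro φ hφ
    rcases (hx φ hφ).eq_or_lt with h0 | hpos
    · refine Eventually.of_forall fun ε => ?_
      simp [← h0, h φ hφ h0.symm]
    · have hlim : Tendsto (fun ε : ℝ => φ x + ε * (φ x - φ y)) (𝓝[>] 0)
          (𝓝 (φ x + 0 * (φ x - φ y))) :=
        ((by fun_prop : Continuous fun ε : ℝ => φ x + ε * (φ x - φ y)).tendsto 0).mono_left
          nhdsWithin_le_nhds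
      rw [zero_mul, add_zero] at hlim
      filter_upwards [hlim.eventually (lt_mem_nhds hpos)] with ε hε
      simpa using hε.le
  obtain ⟨ε, h1, h2⟩ := (key.and self_mem_nhdsWithin).exists
  exact ⟨ε, h2, h1⟩

/-- The face of `dualCone s` on which the forms in `I` vanish. -/
noncomputable def dualConeFace (s I : Finset (V →ₗ[ℝ] ℝ)) : Set V :=
  {x | x ∈ dualCone s ∧ ∀ φ ∈ I, φ x = 0}

theorem exists_dualConeFace_eq (s I : Finset (V →ₗ[ℝ] ℝ)) :
    ∃ s', dualConeFace s I = dualCone s' := by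
  classical
  refine ⟨s ∪ I ∪ I.image (fun φ => -φ), ?_⟩
  ext x
  constructor
  · rintro ⟨h1, h2⟩ φ hφ
    simp only [Finset.mem_union, Finset.mem_image] at hφ
    obtain (h | h) | ⟨ψ, h, rfl⟩ := hφ
    · exact h1 φ h
    · exact (h2 φ h).ge
    · simp [h2 ψ h]
  · intro h
    refine ⟨fun φ hφ => h φ (by simp [hφ]), fun φ hφ => le_antisymm ?_ (h φ (by simp [hφ]))⟩
    have := h (-φ) (Finset.mem_union_right _ (Finset.mem_image_of_mem _ hφ))
    simpa using this

theorem mem_intrinsicInterior_dualConeFace [FiniteDimensional ℝ V] {s I : Finset (V →ₗ[ℝ] ℝ)}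
    {x : V} (hx : x ∈ dualConeFace s I) (h : ∀ φ ∈ s, φ x = 0 → φ ∈ I) :
    x ∈ intrinsicInterior ℝ (dualConeFace s I) := by
  have hconv : Convex ℝ (dualConeFace s I) := by
    obtain ⟨s', hs'⟩ := exists_dualConeFace_eq s I
    rw [hs']
    exact convex_dualCone s'
  refine mem_intrinsicInterior_of_prolong hconv hx fun y hy => ?_
  obtain ⟨ε, hε, hxy⟩ := dualCone_prolong hx.1 fun φ hφ hφx => hy.2 φ (h φ hφ hφx)
  refine ⟨ε, hε, hxy, fun φ hφ => ?_⟩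
  simp [hx.2 φ hφ, hy.2 φ hφ]

/-- Sum, over the forms in `s`, points of the cone where the form is positive, if there are any. -/
theorem exists_generic_point (s : Finset (V →ₗ[ℝ] ℝ)) :
    ∃ y ∈ dualCone s, ∀ φ ∈ s, φ y = 0 → ∀ z ∈ dualCone s, φ z = 0 := by
  have h : ∀ φ : V →ₗ[ℝ] ℝ, ∃ y ∈ dualCone s, φ y = 0 → ∀ z ∈ dualCone s, φ z = 0 := by
    intro φ
    by_cases hφ : ∃ y ∈ dualCone s, φ y ≠ 0
    · obtain ⟨y, hy, hne⟩ := hφ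
      exact ⟨y, hy, fun h => absurd h hne⟩
    · push Not at hφ
      exact ⟨0, zero_mem_dualCone s, fun _ => hφ⟩
  choose y hy hφ using h
  refine ⟨∑ ψ ∈ s, y ψ, fun φ hφs => ?_, fun φ hφs h0 => hφ φ ?_⟩
  · rw [map_sum]
    exact Finset.sum_nonneg fun ψ _ => hy ψ φ hφs
  · rw [map_sum] at h0
    exact (Finset.sum_eq_zero_iff_of_nonneg fun ψ _ => hy ψ φ hφs).1 h0 φ hφs

/-- A polyhedral cone on which a linear form is coercive is finitely generated. -/
theorem exists_finite_generators [FiniteDimensional ℝ V] (s : Finset (V →ₗ[ℝ] ℝ))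
    (ξ : V →ₗ[ℝ] ℝ) {ε : ℝ} (hε : 0 < ε) (hξ : ∀ x ∈ dualCone s, ε * ‖x‖ ≤ ξ x) :
    ∃ G : Finset V, (G : Set V) ⊆ dualCone s ∧ dualCone s ⊆ PointedCone.hull ℝ (G : Set V) := by
  classical
  set Q : Set V := dualCone s ∩ {x | ξ x = 1} with hQ
  have hQconv : Convex ℝ Q := (convex_dualCone s).inter (convex_hyperplane ξ.isLinear 1)
  have hQcomp : IsCompact Q := by
    refine Metric.isCompact_of_isClosed_isBounded ((isClosed_dualCone s).inter
      (isClosed_eq ξ.continuous_of_finiteDimensional continuous_const))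
      (isBounded_iff_forall_norm_le.2 ⟨1 / ε, fun x hx => ?_⟩)
    rw [le_div_iff₀ hε, mul_comm, ← hx.2]
    exact hξ x hx.1
  -- An extreme point of the compact slice `Q` is determined by its active forms: with equal active
  -- sets, the segment from `y` to `x` could be prolonged beyond `x`.
  have hfin : (Q.extremePoints ℝ).Finite := by
    refine Set.Finite.of_injOn (f := fun x => s.filter fun φ => φ x = 0) (t := s.powerset)
      (fun x _ => Finset.mem_coe.2 (Finset.mem_powerset.2 (Finset.filter_subset _ _))) ?_
      (Finset.finite_toSet _)
    intro x hx y hy hxy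
    have hact : ∀ φ ∈ s, φ x = 0 → φ y = 0 := fun φ hφ h =>
      (Finset.mem_filter.1 ((Finset.ext_iff.1 hxy φ).1 (Finset.mem_filter.2 ⟨hφ, h⟩))).2
    obtain ⟨δ, hδ, hmem⟩ := dualCone_prolong hx.1.1 hact
    have hmem' : x + δ • (x - y) ∈ Q := by
      refine ⟨hmem, ?_⟩
      have h1 : ξ x = 1 := hx.1.2
      have h2 : ξ y = 1 := hy.1.2
      simp [h1, h2]
    have hyx := minFace_subset_of_isExtreme (isExtreme_singleton.2 hx) (mem_singleton x)
      ⟨hy.1, δ, hδ, hmem'⟩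
    exact (mem_singleton_iff.1 hyx).symm
  refine ⟨hfin.toFinset, fun x hx => ?_, fun x hx => ?_⟩
  · rw [hfin.coe_toFinset] at hx
    exact hx.1.1
  · rw [hfin.coe_toFinset]
    rcases eq_or_ne x 0 with rfl | hx0
    · exact zero_mem _
    have hpos : 0 < ξ x := (mul_pos hε (norm_pos_iff.2 hx0)).trans_le (hξ x hx)
    have hmem : (ξ x)⁻¹ • x ∈ Q := by
      refine ⟨smul_mem_dualCone hx (inv_pos.2 hpos).le, ?_⟩
      simp [hpos.ne']
    rw [← closure_convexHull_extremePoints hQcomp hQconv,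
      (hfin.isCompact_convexHull (𝕜 := ℝ)).isClosed.closure_eq] at hmem
    have hhull : convexHull ℝ (Q.extremePoints ℝ) ⊆ PointedCone.hull ℝ (Q.extremePoints ℝ) :=
      convexHull_min PointedCone.subset_hull (PointedCone.convex _)
    exact (PointedCone.smul_mem_iff _ (inv_pos.2 hpos)).1 (hhull hmem)

end Polyhedral

/-! ### Nondegenerate open cones and coercive forms -/

section OpenCone

open Set Filter Topology

variable {V : Type*} [NormedAddCommGroup V] [NormedSpace ℝ V] {C : Set V}

theorem smul_mem_closure_cone (hC_cone : IsCone C) {t : ℝ} (ht : 0 ≤ t) {x : V}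
    (hx : x ∈ closure C) : t • x ∈ closure C := by
  have hpos : ∀ {t : ℝ}, 0 < t → ∀ {x : V}, x ∈ closure C → t • x ∈ closure C :=
    fun ht _ hx => map_mem_closure (continuous_const_smul _) hx fun y hy => hC_cone.2 _ ht y hy
  rcases ht.eq_or_lt with rfl | ht
  · obtain ⟨y, hy⟩ := hC_cone.1
    have hlim : Tendsto (fun s : ℝ => s • y) (𝓝[>] 0) (𝓝 ((0 : ℝ) • y)) :=
      ((by fun_prop : Continuous fun s : ℝ => s • y).tendsto 0).mono_left nhdsWithin_le_nhds
    rw [zero_smul] at hlim ⊢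
    exact mem_closure_of_tendsto hlim
      (eventually_mem_nhdsWithin.mono fun s hs => hC_cone.2 s hs y hy)
  · exact hpos ht hx

theorem add_mem_open_cone (hC_open : IsOpen C) (hC_convex : Convex ℝ C) (hC_cone : IsCone C)
    {x y : V} (hx : x ∈ C) (hy : y ∈ closure C) : x + y ∈ C := by
  have h := hC_convex.openSegment_interior_closure_subset_interior (x := (2 : ℝ) • x)
    (y := (2 : ℝ) • y) (hC_open.interior_eq.symm ▸ hC_cone.2 2 two_pos x hx)
    (smul_mem_closure_cone hC_cone zero_le_two hy)
  refine interior_subset (h ⟨1 / 2, 1 / 2, by norm_num, by norm_num, by norm_num, ?_⟩)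
  module

theorem eq_zero_of_mem_closure_of_neg_mem (hC_open : IsOpen C) (hC_convex : Convex ℝ C)
    (hC_cone : IsCone C) (hC_nondeg : IsNondegenerate C) {v : V} (hv : v ∈ closure C)
    (hv' : -v ∈ closure C) : v = 0 := by
  by_contra hne
  obtain ⟨x, hx⟩ := hC_cone.1
  refine hC_nondeg x v hne fun t => ?_
  refine add_mem_open_cone hC_open hC_convex hC_cone hx ?_
  rcases le_total 0 t with ht | ht
  · exact smul_mem_closure_cone hC_cone ht hv
  · simpa using smul_mem_closure_cone hC_cone (neg_nonneg.2 ht) hv'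

theorem exists_form_pos (hC_convex : Convex ℝ C) (hC_cone : IsCone C) {v : V}
    (hv : -v ∉ closure C) : ∃ f : StrongDual ℝ V, (∀ x ∈ closure C, 0 ≤ f x) ∧ 0 < f v := by
  obtain ⟨f, u, hfu, hu⟩ :=
    geometric_hahn_banach_point_closed hC_convex.closure isClosed_closure hv
  have h0 : (0 : V) ∈ closure C := by
    obtain ⟨y, hy⟩ := hC_cone.1
    simpa using smul_mem_closure_cone hC_cone le_rfl (subset_closure hy)
  have hu0 : u < 0 := by simpa using hu 0 h0
  refine ⟨f, fun x hx => ?_, ?_⟩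
  · by_contra! hneg
    have := hu _ (smul_mem_closure_cone hC_cone (t := u / f x)
      (div_nonneg_of_nonpos hu0.le hneg.le) hx)
    rw [map_smul, smul_eq_mul, div_mul_cancel₀ _ hneg.ne] at this
    exact lt_irrefl _ this
  · rw [map_neg] at hfu
    linarith

/-- By compactness of the unit vectors in the closure, a finite sum of separating forms is positive
on all of them. -/
theorem exists_coercive_form [FiniteDimensional ℝ V] (hC_open : IsOpen C)
    (hC_convex : Convex ℝ C) (hC_cone : IsCone C) (hC_nondeg : IsNondegenerate C) :
    ∃ (f : V →ₗ[ℝ] ℝ) (u : ℝ), 0 < u ∧ ∀ x ∈ closure C, u * ‖x‖ ≤ f x := by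
  classical
  have hQ : IsCompact (closure C ∩ Metric.sphere 0 1) :=
    (isCompact_sphere 0 1).inter_left isClosed_closure
  have hpos : ∀ v ∈ closure C ∩ Metric.sphere 0 1, ∃ f : StrongDual ℝ V,
      (∀ x ∈ closure C, 0 ≤ f x) ∧ 0 < f v := fun v hv =>
    exists_form_pos hC_convex hC_cone fun h => by
      have := eq_zero_of_mem_closure_of_neg_mem hC_open hC_convex hC_cone hC_nondeg hv.1 h
      simpa [this] using hv.2
  choose! f hf hfv using hpos
  obtain ⟨t, ht, hcover⟩ := hQ.elim_nhds_subcover (fun v => {x | 0 < f v x}) fun v hv =>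
    (isOpen_lt continuous_const (f v).continuous).mem_nhds (hfv v hv)
  set g : StrongDual ℝ V := ∑ v ∈ t, f v with hg
  have hgpos : ∀ x ∈ closure C ∩ Metric.sphere 0 1, 0 < g x := by
    intro x hx
    obtain ⟨v, hv, hvx⟩ := mem_iUnion₂.1 (hcover hx)
    have : g x = ∑ v ∈ t, f v x := by simp [hg]
    rw [this]
    exact Finset.sum_pos' (fun w hw => hf w (ht w hw) x hx.1) ⟨v, hv, hvx⟩
  obtain ⟨u, hu, hle⟩ : ∃ u : ℝ, 0 < u ∧ ∀ x ∈ closure C ∩ Metric.sphere 0 1, u ≤ g x := by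
    rcases (closure C ∩ Metric.sphere (0 : V) 1).eq_empty_or_nonempty with he | hne
    · exact ⟨1, one_pos, by simp [he]⟩
    · obtain ⟨x, hx, hmin⟩ := hQ.exists_isMinOn hne g.continuous.continuousOn
      exact ⟨g x, hgpos x hx, hmin⟩
  refine ⟨g, u, hu, fun x hx => ?_⟩
  rcases eq_or_ne x 0 with rfl | hx0
  · simp
  have hnorm : 0 < ‖x‖ := norm_pos_iff.2 hx0
  have := hle (‖x‖⁻¹ • x) ⟨smul_mem_closure_cone hC_cone (inv_nonneg.2 hnorm.le) hx, by
    simp [norm_smul, hnorm.ne']⟩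
  rw [map_smul, smul_eq_mul, inv_mul_eq_div, le_div_iff₀ hnorm] at this
  exact this

end OpenCone

/-! ### Integral forms and lattice points in the cone -/

section Lattice

open Set Filter Topology Module

variable {V : Type*} [NormedAddCommGroup V] [NormedSpace ℝ V] [FiniteDimensional ℝ V]

theorem exists_lattice_basis (L : Submodule ℤ V) (h : ∃ _ : DiscreteTopology L, IsZLattice ℝ L) :
    ∃ (n : ℕ) (b : Basis (Fin n) ℝ V), Submodule.span ℤ (range b) = L := by
  obtain ⟨_, _⟩ := h
  have := ZLattice.module_free ℝ L
  have := ZLattice.module_finite ℝ L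
  exact ⟨_, (finBasis ℤ L).ofZLatticeBasis ℝ L, Basis.ofZLatticeBasis_span ℝ L _⟩

variable {C : Set V} {L : Submodule ℤ V}

/-- Scale a coercive form by a large `N` and round its values on a lattice basis. The rounding error
is at most `M * ‖x‖`, and `N * u > M + 1` leaves `‖x‖`. -/
theorem exists_integral_coercive_form (hC_open : IsOpen C) (hC_convex : Convex ℝ C)
    (hC_cone : IsCone C) (hC_nondeg : IsNondegenerate C)
    (hL : ∃ _ : DiscreteTopology L, IsZLattice ℝ L) :
    ∃ ξ : V →ₗ[ℝ] ℝ, (∀ v ∈ L, ∃ m : ℤ, ξ v = m) ∧ ∀ x ∈ closure C, ‖x‖ ≤ ξ x := by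
  obtain ⟨n, b, rfl⟩ := exists_lattice_basis L hL
  obtain ⟨f, u, hu, hf⟩ := exists_coercive_form hC_open hC_convex hC_cone hC_nondeg
  set M : ℝ := ∑ i, ‖(b.coord i).toContinuousLinearMap‖ with hM
  obtain ⟨N, hN⟩ := exists_nat_gt ((M + 1) / u)
  rw [div_lt_iff₀ hu] at hN
  refine ⟨b.constr ℝ fun i => (⌊N * f (b i)⌋ : ℝ), fun v hv => ?_, fun x hx => ?_⟩
  · induction hv using Submodule.span_induction with
    | mem v hv =>
      obtain ⟨i, rfl⟩ := hv
      exact ⟨_, b.constr_basis ℝ _ i⟩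
    | zero => exact ⟨0, by simp⟩
    | add v w _ _ hv hw =>
      obtain ⟨m, hm⟩ := hv
      obtain ⟨k, hk⟩ := hw
      exact ⟨m + k, by rw [map_add, hm, hk]; push_cast; rfl⟩
    | smul k v _ hv =>
      obtain ⟨m, hm⟩ := hv
      exact ⟨k * m, by rw [map_zsmul, hm]; simp⟩
  · have hcoord : ∀ i, |b.repr x i| ≤ ‖(b.coord i).toContinuousLinearMap‖ * ‖x‖ := fun i => by
      simpa using (b.coord i).toContinuousLinearMap.le_opNorm x
    have hfx : f x = ∑ i, b.repr x i * f (b i) := by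
      have := congrArg f (b.sum_repr x)
      simp only [map_sum, map_smul, smul_eq_mul] at this
      exact this.symm
    have hdiff : N * f x - ∑ i, b.repr x i * ⌊N * f (b i)⌋ ≤ M * ‖x‖ := by
      rw [hfx, Finset.mul_sum, ← Finset.sum_sub_distrib, hM, Finset.sum_mul]
      refine Finset.sum_le_sum fun i _ => ?_
      rw [show N * (b.repr x i * f (b i)) - b.repr x i * ⌊N * f (b i)⌋ =
        b.repr x i * Int.fract (N * f (b i)) by rw [Int.fract]; ring]
      calc b.repr x i * Int.fract (N * f (b i)) ≤ |b.repr x i * Int.fract (N * f (b i))| :=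
            le_abs_self _
        _ = |b.repr x i| * Int.fract (N * f (b i)) := by rw [abs_mul, Int.abs_fract]
        _ ≤ |b.repr x i| := mul_le_of_le_one_right (abs_nonneg _) (Int.fract_lt_one _).le
        _ ≤ _ := hcoord i
    have hval : b.constr ℝ (fun i => (⌊N * f (b i)⌋ : ℝ)) x =
        ∑ i, b.repr x i * ⌊N * f (b i)⌋ := by
      rw [Basis.constr_apply_fintype]
      simp
    rw [hval]
    have h1 := mul_le_mul_of_nonneg_left (hf x hx) (Nat.cast_nonneg (α := ℝ) N)
    have h2 := mul_le_mul_of_nonneg_right hN.le (norm_nonneg x)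
    nlinarith

/-- The points `⌊N x⌋ / N` tend to `x`, hence eventually lie in the open cone `C`, as do the lattice
points `⌊N x⌋`. -/
theorem nonneg_on_cone_of_nonneg_on_lattice (hC_open : IsOpen C) (hC_cone : IsCone C)
    (hL : ∃ _ : DiscreteTopology L, IsZLattice ℝ L) (ξ : V →ₗ[ℝ] ℝ)
    (hξ : ∀ a ∈ closure C ∩ L, 0 ≤ ξ a) {x : V} (hx : x ∈ C) : 0 ≤ ξ x := by
  obtain ⟨n, b, rfl⟩ := exists_lattice_basis L hL
  let y : ℕ → V := fun N => x - (N : ℝ)⁻¹ • ZSpan.fract b ((N : ℝ) • x)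
  have hy : Tendsto y atTop (𝓝 x) := by
    have : Tendsto (fun N : ℕ => (N : ℝ)⁻¹ • ZSpan.fract b ((N : ℝ) • x)) atTop (𝓝 0) := by
      refine NormedField.tendsto_zero_smul_of_tendsto_zero_of_bounded
        (tendsto_inv_atTop_zero.comp tendsto_natCast_atTop_atTop)
        (isBoundedUnder_of ⟨∑ i, ‖b i‖, fun N => ZSpan.norm_fract_le b _⟩)
    simpa using tendsto_const_nhds.sub this
  refine ge_of_tendsto ((ξ.continuous_of_finiteDimensional.tendsto x).comp hy) ?_
  filter_upwards [hy.eventually (hC_open.mem_nhds hx), eventually_gt_atTop 0] with N hN hpos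
  have hN0 : (0 : ℝ) < N := Nat.cast_pos.2 hpos
  have hfloor : (N : ℝ) • y N = ZSpan.floor b ((N : ℝ) • x) := by
    simp only [y]
    rw [smul_sub, smul_inv_smul₀ hN0.ne', ZSpan.fract_apply, sub_sub_cancel]
  have := hξ _ ⟨subset_closure (hC_cone.2 _ hN0 _ hN),
    by rw [hfloor]; exact (ZSpan.floor b ((N : ℝ) • x)).2⟩
  rw [map_smul, smul_eq_mul] at this
  exact nonneg_of_mul_nonneg_right this hN0

theorem span_closure_inter_lattice (hC_open : IsOpen C) (hC_cone : IsCone C)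
    (hL : ∃ _ : DiscreteTopology L, IsZLattice ℝ L) :
    Submodule.span ℝ (closure C ∩ L) = ⊤ := by
  by_contra hne
  obtain ⟨f, hf, hker⟩ := Submodule.exists_le_ker_of_lt_top _ (lt_top_iff_ne_top.2 hne)
  have hvan : ∀ a ∈ closure C ∩ L, f a = 0 := fun a ha => hker (Submodule.subset_span ha)
  have hC0 : ∀ x ∈ C, f x = 0 := by
    intro x hx
    refine le_antisymm ?_
      (nonneg_on_cone_of_nonneg_on_lattice hC_open hC_cone hL f (fun a ha => (hvan a ha).ge) hx)
    have := nonneg_on_cone_of_nonneg_on_lattice hC_open hC_cone hL (-f)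
      (fun a ha => by simp [hvan a ha]) hx
    simpa using this
  have htop := (hC_open.affineSpan_eq_top hC_cone.1)
  refine hf (LinearMap.ext_on (s := C) ?_ fun x hx => by simpa using hC0 x hx)
  rw [eq_top_iff]
  intro x _
  have hx : x ∈ affineSpan ℝ C := htop ▸ AffineSubspace.mem_top ℝ V x
  exact affineSpan_subset_span hx

end Lattice

/-! ### Rational vectors as quotients of lattice vectors -/

section Rational

open Module

variable {V : Type*} [NormedAddCommGroup V] [NormedSpace ℝ V]

theorem exists_smul_mem_lattice [Module ℚ V] [IsScalarTower ℚ ℝ V] {VQ : Submodule ℚ V}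
    {L : Submodule ℤ V}
    (hVQ : IsRationalStructure VQ) (hL : IsRationalLattice VQ L) {v : V} (hv : v ∈ VQ) :
    ∃ n : ℕ, 0 < n ∧ (n : ℝ) • v ∈ L := by
  obtain ⟨hlat, hLVQ⟩ := hL
  -- A rational functional killing `L` but not `v` would extend to a real form by base change, and
  -- that form vanishes since `L` spans `V`.
  have hspan : v ∈ Submodule.span ℚ (L : Set V) := by
    by_contra hnot
    let p : Submodule ℚ VQ := (Submodule.span ℚ (L : Set V)).comap VQ.subtype
    have hp : (⟨v, hv⟩ : VQ) ∉ p := hnot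
    obtain ⟨f, hf, hker⟩ := Submodule.exists_le_ker_of_notMem hp
    let g : VQ →ₗ[ℚ] ℝ := Algebra.linearMap ℚ ℝ ∘ₗ f
    have hlift : IsBaseChange ℝ VQ.subtype := hVQ
    have h0 : hlift.lift g = 0 := by
      obtain ⟨_, hz⟩ := hlat
      refine LinearMap.ext_on hz.span_top fun w hw => ?_
      have := hlift.lift_eq g ⟨w, hLVQ hw⟩
      simp only [Submodule.subtype_apply] at this
      rw [this, LinearMap.zero_apply]
      have hw' : (⟨w, hLVQ hw⟩ : VQ) ∈ p := Submodule.subset_span hw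
      have : f ⟨w, hLVQ hw⟩ = 0 := hker hw'
      simp [g, this]
    have := hlift.lift_eq g ⟨v, hv⟩
    rw [h0, LinearMap.zero_apply] at this
    simp only [g, LinearMap.comp_apply, Algebra.linearMap_apply, eq_ratCast] at this
    exact hf (by exact_mod_cast this.symm)
  clear hv
  induction hspan using Submodule.span_induction with
  | mem v hv => exact ⟨1, one_pos, by simpa using hv⟩
  | zero => exact ⟨1, one_pos, by simp⟩
  | add v w _ _ hv hw =>
    obtain ⟨m, hm, hmv⟩ := hv
    obtain ⟨k, hk, hkw⟩ := hw
    refine ⟨m * k, Nat.mul_pos hm hk, ?_⟩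
    have := L.add_mem (L.smul_mem (k : ℤ) hmv) (L.smul_mem (m : ℤ) hkw)
    convert this using 1
    rw [← Int.cast_smul_eq_zsmul ℝ, ← Int.cast_smul_eq_zsmul ℝ]
    push_cast
    module
  | smul q v _ hv =>
    obtain ⟨m, hm, hmv⟩ := hv
    refine ⟨m * q.den, Nat.mul_pos hm q.den_pos, ?_⟩
    have := L.smul_mem q.num hmv
    convert this using 1
    rw [← Int.cast_smul_eq_zsmul ℝ, ← algebraMap_smul ℝ q v, smul_smul, smul_smul]
    congr 1
    have : (q.den : ℝ) * q = q.num := by exact_mod_cast Rat.den_mul_eq_num q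
    rw [eq_ratCast]
    push_cast
    rw [mul_assoc, this]
    ring

end Rational

/-! ### Passage to the span of the lattice points of a face -/

section Restriction

open Set

variable {V : Type*} [NormedAddCommGroup V] [NormedSpace ℝ V]

theorem IsInner.restrict {A : Set V} {x : Submodule.span ℝ A} (hx : IsInner A (x : V)) :
    IsInner ((↑) ⁻¹' A : Set (Submodule.span ℝ A)) x := by
  intro b hb
  obtain ⟨ε, hε, h⟩ := hx b hb
  refine ⟨ε, hε, fun ξ hξ => ?_⟩
  obtain ⟨ζ, rfl⟩ := ξ.exists_extend
  exact h ζ fun a ha => hξ ⟨a, Submodule.subset_span ha⟩ ha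

theorem restrict_mem_properForms {A : Set V} {ξ : Module.Dual ℝ V} (hξ : ξ ∈ properForms A) :
    ξ ∘ₗ (Submodule.span ℝ A).subtype ∈
      properForms ((↑) ⁻¹' A : Set (Submodule.span ℝ A)) :=
  ⟨fun a ha => hξ.1 a ha, fun c => Set.Finite.of_injOn (f := (↑)) (fun _ ha => ha)
    Subtype.val_injective.injOn (hξ.2 c)⟩

/-- The inner points for `A` in the cone generated by `S`, as points of the span of `A`. -/
def innerPart (A S : Set V) : Set (Submodule.span ℝ A) :=
  {x | IsInner A (x : V) ∧ (x : V) ∈ PointedCone.hull ℝ S}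

variable [FiniteDimensional ℝ V]

theorem finite_minimizers_restrict {A : Set V} {S : Finset V} (hS : (S : Set V) ⊆ A) :
    {ξ | ∃ x ∈ innerPart A S, ξ ∈ minimizers ((↑) ⁻¹' A : Set (Submodule.span ℝ A)) x}.Finite := by
  have hinj : Set.InjOn ((↑) : Submodule.span ℝ A → V) ((↑) ⁻¹' (S : Set V)) :=
    Subtype.val_injective.injOn
  refine (finite_minimizers_of_mem_cone (A := ((↑) ⁻¹' A : Set (Submodule.span ℝ A)))
    Submodule.span_span_coe_preimage (S.preimage (↑) hinj) ?_).subset ?_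
  · intro s hs
    simp only [Finset.coe_preimage, mem_preimage] at hs
    exact hS hs
  · rintro ξ ⟨x, ⟨hx, hxS⟩, hξ⟩
    refine ⟨x, hx.restrict, ?_, hξ⟩
    obtain ⟨f, -, hf⟩ := Submodule.mem_span_finset.1 hxS
    refine ⟨fun s => (f s : ℝ), fun s => (f s).2, Subtype.val_injective ?_⟩
    rw [← hf, AddSubmonoidClass.coe_finsetSum]
    simp only [Submodule.coe_smul]
    rw [Finset.sum_preimage (f := ((↑) : Submodule.span ℝ A → V)) S hinj
      (fun s => (f s : ℝ) • s)]
    · rfl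
    · intro s hs hns
      exact absurd ⟨⟨s, Submodule.subset_span (hS hs)⟩, rfl⟩ hns

/-- Only restrictions can be counted: `A` need not span `V`, and `finite_isomorphisms` applies
between the two spans. -/
theorem finite_restrictions {A A' : Set V} (hD : (properForms A').Nonempty) {S S' : Finset V}
    (hS : (S : Set V) ⊆ A) (hS' : (S' : Set V) ⊆ A') :
    ((fun (γ : V ≃ₗ[ℝ] V) (a : Submodule.span ℝ A) => γ a) '' {γ | γ '' A = A' ∧
      ∃ x, IsInner A x ∧ x ∈ PointedCone.hull ℝ (S : Set V) ∧
        IsInner A' (γ x) ∧ γ x ∈ PointedCone.hull ℝ (S' : Set V)}).Finite := by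
  obtain ⟨ξ, hξ⟩ := hD
  have hspan : ∀ {A : Set V} {S : Finset V}, (S : Set V) ⊆ A → ∀ {x : V},
      x ∈ PointedCone.hull ℝ (S : Set V) → x ∈ Submodule.span ℝ A := fun hS _ hx =>
    Submodule.span_mono hS (PointedCone.hull_le_span ℝ _ hx)
  have key : {g : Submodule.span ℝ A ≃ₗ[ℝ] Submodule.span ℝ A' |
      g '' ((↑) ⁻¹' A) = ((↑) ⁻¹' A') ∧ ∃ x ∈ innerPart A S, g x ∈ innerPart A' S'}.Finite := by
    refine finite_isomorphisms Submodule.span_span_coe_preimage Submodule.span_span_coe_preimage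
      ⟨_, restrict_mem_properForms hξ⟩ (fun y hy => ?_) (finite_minimizers_restrict hS)
      (finite_minimizers_restrict hS')
    exact hy.1.restrict
  refine (key.image fun (g : Submodule.span ℝ A ≃ₗ[ℝ] Submodule.span ℝ A')
    (a : Submodule.span ℝ A) => (g a : V)).subset ?_
  rintro _ ⟨γ, ⟨rfl, x, hx, hxS, hγx, hγxS⟩, rfl⟩
  have hmap : (Submodule.span ℝ A).map (γ : V →ₗ[ℝ] V) = Submodule.span ℝ (γ '' A) :=
    Submodule.map_span _ _
  refine ⟨γ.ofSubmodules _ _ hmap, ⟨?_, ⟨x, hspan hS hxS⟩, ⟨hx, hxS⟩, ?_⟩, ?_⟩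
  · ext y
    constructor
    · rintro ⟨a, ha, rfl⟩
      rw [mem_preimage, LinearEquiv.ofSubmodules_apply]
      exact mem_image_of_mem γ ha
    · intro hy
      obtain ⟨a, ha, hay⟩ : (y : V) ∈ γ '' A := hy
      refine ⟨⟨a, Submodule.subset_span ha⟩, ha, Subtype.val_injective ?_⟩
      rw [LinearEquiv.ofSubmodules_apply]
      exact hay
  · exact ⟨hγx, hγxS⟩
  · rfl

end Restriction

/-! ### The cone `C₊` -/

section RationalHull

open Set

variable {V : Type*} [NormedAddCommGroup V] [NormedSpace ℝ V] [Module ℚ V]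
  {VQ : Submodule ℚ V} {C : Set V}

theorem rationalHull_subset_closure (hC_convex : Convex ℝ C) :
    rationalHull VQ C ⊆ closure C :=
  convexHull_min inter_subset_left hC_convex.closure

theorem zero_mem_rationalHull (hC_cone : IsCone C) : (0 : V) ∈ rationalHull VQ C := by
  obtain ⟨y, hy⟩ := hC_cone.1
  refine subset_convexHull ℝ _ ⟨?_, VQ.zero_mem⟩
  simpa using smul_mem_closure_cone hC_cone le_rfl (subset_closure hy)

theorem smul_mem_rationalHull (hC_cone : IsCone C) {t : ℝ} (ht : 0 ≤ t) {x : V}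
    (hx : x ∈ rationalHull VQ C) : t • x ∈ rationalHull VQ C := by
  have hsub : t • (closure C ∩ VQ) ⊆ rationalHull VQ C := by
    rintro _ ⟨z, ⟨hz, hzQ⟩, rfl⟩
    -- For real `t`, `t • z` need not be rational, but it lies between `0` and the rational point `n
    -- • z`.
    obtain ⟨n, hn⟩ := exists_nat_gt t
    have hn0 : (0 : ℝ) < n := ht.trans_lt hn
    have hmem : (n : ℝ) • z ∈ rationalHull VQ C := by
      refine subset_convexHull ℝ _ ⟨smul_mem_closure_cone hC_cone hn0.le hz, ?_⟩
      rw [Nat.cast_smul_eq_nsmul]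
      exact VQ.toAddSubmonoid.nsmul_mem hzQ n
    have := (convex_convexHull ℝ _).smul_mem_of_zero_mem (zero_mem_rationalHull hC_cone) hmem
      (t := t / n) ⟨by positivity, (div_le_one hn0).2 hn.le⟩
    rwa [smul_smul, div_mul_cancel₀ _ hn0.ne'] at this
  have := convexHull_min hsub (convex_convexHull ℝ _)
  rw [convexHull_smul] at this
  exact this ⟨x, hx, rfl⟩

end RationalHull

/-! ### The Siegel property -/

section Siegel

open Set

variable {V : Type*} [NormedAddCommGroup V] [NormedSpace ℝ V]
  {C F : Set V} {L : Submodule ℤ V}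

theorem face_subset_hull [Module ℚ V] {VQ : Submodule ℚ V} (hC_cone : IsCone C)
    (hLQ : ∀ v ∈ VQ, ∃ n : ℕ, 0 < n ∧ (n : ℝ) • v ∈ L) (hF : IsFace (rationalHull VQ C) F) :
    F ⊆ PointedCone.hull ℝ ((L : Set V) ∩ F) := by
  refine (face_subset_convexHull hF.2.2).trans (convexHull_min ?_ (PointedCone.convex _))
  rintro z ⟨⟨-, hzQ⟩, hzF⟩
  obtain ⟨n, hn, hnz⟩ := hLQ z hzQ
  have hn0 : (0 : ℝ) < n := Nat.cast_pos.2 hn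
  refine (PointedCone.smul_mem_iff _ hn0).1 (PointedCone.subset_hull ⟨hnz, ?_⟩)
  exact smul_mem_face (fun t ht x hx => smul_mem_rationalHull hC_cone ht hx) hF hn0.le hzF

/-- A form nonnegative on the lattice points of `F` is nonnegative at `x + ε • (x - b) ∈ F`, so `ε *
ξ b ≤ (1 + ε) * ξ x`. -/
theorem isInner_of_mem_intrinsicInterior (hFL : F ⊆ PointedCone.hull ℝ ((L : Set V) ∩ F)) {x : V}
    (hx : x ∈ intrinsicInterior ℝ F) : IsInner ((L : Set V) ∩ F) x := by
  rintro b ⟨-, hb⟩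
  obtain ⟨ε, hε, h⟩ := exists_prolong_of_mem_intrinsicInterior hx hb
  refine ⟨ε / (1 + ε), by positivity, fun ξ hξ => ?_⟩
  have hnonneg : ∀ y ∈ PointedCone.hull ℝ ((L : Set V) ∩ F), 0 ≤ ξ y := by
    intro y hy
    induction hy using Submodule.span_induction with
    | mem y hy => exact hξ y hy
    | zero => simp
    | add y z _ _ hy hz => rw [map_add]; exact add_nonneg hy hz
    | smul t y _ hy =>
      have : ξ (t • y) = t * ξ y := ξ.map_smul (t : ℝ) y
      rw [this]
      exact mul_nonneg t.2 hy
  have := hnonneg _ (hFL h)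
  simp only [map_add, map_smul, map_sub, smul_eq_mul] at this
  rw [div_mul_eq_mul_div, div_le_iff₀ (by positivity)]
  linarith

theorem mem_properForms_of_coercive [FiniteDimensional ℝ V]
    (hL : ∃ _ : DiscreteTopology L, IsZLattice ℝ L) {ξ : V →ₗ[ℝ] ℝ}
    (hξL : ∀ v ∈ L, ∃ m : ℤ, ξ v = m) {A : Set V} (hAL : A ⊆ L) (hξ : ∀ a ∈ A, ‖a‖ ≤ ξ a) :
    ξ ∈ properForms A := by
  obtain ⟨n, b, rfl⟩ := exists_lattice_basis L hL
  refine ⟨fun a ha => ?_, fun c => ?_⟩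
  · obtain ⟨m, hm⟩ := hξL a (hAL ha)
    have hm0 : 0 ≤ m := by
      have := (norm_nonneg a).trans (hξ a ha)
      rw [hm] at this
      exact_mod_cast this
    lift m to ℕ using hm0
    exact ⟨m, by simpa using hm⟩
  · refine (ZSpan.setFinite_inter b (Metric.isBounded_closedBall (x := (0 : V)) (r := c))).subset ?_
    rintro a ⟨ha, hac⟩
    exact ⟨by simpa using (hξ a ha).trans hac, hAL ha⟩

variable [FiniteDimensional ℝ V]

/-- The cone may be irrational, but each of its finitely many generators is a positive combination
of finitely many lattice points of `F`. -/
theorem exists_lattice_generators {ξ : V →ₗ[ℝ] ℝ} {s : Finset (V →ₗ[ℝ] ℝ)}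
    (hξ : ∀ x ∈ dualCone s, ‖x‖ ≤ ξ x) (hFL : F ⊆ PointedCone.hull ℝ ((L : Set V) ∩ F))
    (hsF : dualCone s ⊆ F) :
    ∃ S : Finset V, (S : Set V) ⊆ (L : Set V) ∩ F ∧
      dualCone s ⊆ PointedCone.hull ℝ (S : Set V) := by
  obtain ⟨G, hG, hGs⟩ := exists_finite_generators s ξ one_pos fun x hx => by simpa using hξ x hx
  obtain ⟨S, hS, hGS⟩ := Submodule.subset_span_finite_of_subset_span ((hG.trans hsF).trans hFL)
  exact ⟨S, hS, fun x hx => Submodule.span_le.2 hGS (hGs hx)⟩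

theorem exists_finite_left_cosets [Module ℚ V] {VQ : Submodule ℚ V}
    (hC_convex : Convex ℝ C) (hC_cone : IsCone C)
    (hL : ∃ _ : DiscreteTopology L, IsZLattice ℝ L)
    (hLQ : ∀ v ∈ VQ, ∃ n : ℕ, 0 < n ∧ (n : ℝ) • v ∈ L)
    {ξ : V →ₗ[ℝ] ℝ} (hξL : ∀ v ∈ L, ∃ m : ℤ, ξ v = m) (hξC : ∀ x ∈ closure C, ‖x‖ ≤ ξ x)
    {Γ : Subgroup (V ≃ₗ[ℝ] V)} (hΓL : ∀ γ : Γ, γ • (L : Set V) = L)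
    (hΓX : ∀ γ : Γ, γ • rationalHull VQ C = rationalHull VQ C)
    {s₁ s₂ : Finset (V →ₗ[ℝ] ℝ)} (h₁ : dualCone s₁ ⊆ rationalHull VQ C)
    (h₂ : dualCone s₂ ⊆ rationalHull VQ C) {F₁ F₂ : Set V}
    (hF₁ : IsCarrierFace (rationalHull VQ C) (dualCone s₁) F₁)
    (hF₂ : IsCarrierFace (rationalHull VQ C) (dualCone s₂) F₂) :
    ∃ T : Set Γ, T.Finite ∧
      {γ : Γ | (γ • intrinsicInterior ℝ (dualCone s₁) ∩
        intrinsicInterior ℝ (dualCone s₂)).Nonempty} = T * (fixingSubgroup Γ F₁ : Set Γ) := by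
  have hXC : rationalHull VQ C ⊆ closure C := rationalHull_subset_closure hC_convex
  obtain ⟨x₁, hx₁⟩ := Set.Nonempty.intrinsicInterior (convex_dualCone s₁) ⟨0, zero_mem_dualCone s₁⟩
  obtain ⟨x₂, hx₂⟩ := Set.Nonempty.intrinsicInterior (convex_dualCone s₂) ⟨0, zero_mem_dualCone s₂⟩
  have hsub₁ := hF₁.subset h₁ hx₁
  have hsub₂ := hF₂.subset h₂ hx₂
  have hhull₁ := face_subset_hull hC_cone hLQ hF₁.1
  have hhull₂ := face_subset_hull hC_cone hLQ hF₂.1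
  obtain ⟨S₁, hS₁, hgen₁⟩ := exists_lattice_generators (fun x hx => hξC x (hXC (h₁ hx))) hhull₁ hsub₁
  obtain ⟨S₂, hS₂, hgen₂⟩ := exists_lattice_generators (fun x hx => hξC x (hXC (h₂ hx))) hhull₂ hsub₂
  have hfin := finite_restrictions
    ⟨ξ, mem_properForms_of_coercive hL hξL (inter_subset_left : (L : Set V) ∩ F₂ ⊆ L)
      fun a ha => hξC a (hXC (hF₂.1.2.2.1 ha.2))⟩ hS₁ hS₂
  set M : Set Γ := {γ : Γ | (γ • intrinsicInterior ℝ (dualCone s₁) ∩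
        intrinsicInterior ℝ (dualCone s₂)).Nonempty} with hM
  let ρ : Γ → Submodule.span ℝ ((L : Set V) ∩ F₁) → V := fun γ a => (γ : V ≃ₗ[ℝ] V) a
  have hρ : (ρ '' M).Finite := by
    refine hfin.subset ?_
    rintro _ ⟨γ, ⟨_, ⟨x, hx, rfl⟩, hγx⟩, rfl⟩
    have hγX : (γ : V ≃ₗ[ℝ] V) '' rationalHull VQ C = rationalHull VQ C := hΓX γ
    have hγL : (γ : V ≃ₗ[ℝ] V) '' (L : Set V) = L := hΓL γ
    -- Both sides are the smallest face of `C₊` containing `γ x`.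
    have hγF : (γ : V ≃ₗ[ℝ] V) '' F₁ = F₂ := by
      rw [hF₁.eq_minFace hx, image_minFace, hγX]
      exact (hF₂.eq_minFace hγx).symm
    refine ⟨γ, ⟨?_, x, isInner_of_mem_intrinsicInterior hhull₁ (hF₁.2 hx),
      hgen₁ (intrinsicInterior_subset hx), isInner_of_mem_intrinsicInterior hhull₂ (hF₂.2 hγx),
      hgen₂ (intrinsicInterior_subset hγx)⟩, rfl⟩
    rw [image_inter (γ : V ≃ₗ[ℝ] V).injective, hγL, hγF]
  -- `T` picks one element of `M` for each restriction to the span; equal restrictions differ by an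
  -- element fixing `F₁`.
  obtain ⟨T, hTM, hT⟩ := Set.exists_subset_bijOn M ρ
  refine ⟨T, Set.Finite.of_finite_image (hT.image_eq ▸ hρ) hT.injOn, Subset.antisymm ?_ ?_⟩
  · intro γ hγ
    obtain ⟨t, ht, htγ⟩ := hT.surjOn ⟨γ, hγ, rfl⟩
    refine ⟨t, ht, t⁻¹ * γ, ?_, by simp⟩
    refine (mem_fixingSubgroup_iff Γ).2 fun y hy => ?_
    have hy' : y ∈ Submodule.span ℝ ((L : Set V) ∩ F₁) :=
      PointedCone.hull_le_span ℝ _ (hhull₁ hy)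
    have hval : t • y = γ • y := congrFun htγ ⟨y, hy'⟩
    rw [mul_smul, ← hval, inv_smul_smul]
  · rintro _ ⟨t, ht, z, hz, rfl⟩
    obtain ⟨_, ⟨x, hx, rfl⟩, htx⟩ := hTM ht
    refine ⟨t • x, ⟨x, hx, ?_⟩, htx⟩
    have : z • x = x := (mem_fixingSubgroup_iff Γ).1 hz x (hsub₁ (intrinsicInterior_subset hx))
    change (t * z) • x = t • x
    rw [mul_smul, this]

/-- The intersection of two polyhedral cones is the intersection of two of their faces with
intersecting relative interiors. -/
theorem exists_faces_inter_eq (γ : V ≃ₗ[ℝ] V) (s₁ s₂ : Finset (V →ₗ[ℝ] ℝ)) :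
    ∃ I ⊆ s₁, ∃ J ⊆ s₂,
      γ '' dualCone s₁ ∩ dualCone s₂ = γ '' dualConeFace s₁ I ∩ dualConeFace s₂ J ∧
      (γ '' intrinsicInterior ℝ (dualConeFace s₁ I) ∩
        intrinsicInterior ℝ (dualConeFace s₂ J)).Nonempty := by
  classical
  let s : Finset (V →ₗ[ℝ] ℝ) := s₁.image (fun φ => φ ∘ₗ (γ.symm : V →ₗ[ℝ] V)) ∪ s₂
  have hs {z : V} : z ∈ dualCone s ↔ γ.symm z ∈ dualCone s₁ ∧ z ∈ dualCone s₂ := by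
    constructor
    · intro h
      exact ⟨fun φ hφ => h (φ ∘ₗ (γ.symm : V →ₗ[ℝ] V))
        (Finset.mem_union_left _ (Finset.mem_image_of_mem _ hφ)),
        fun φ hφ => h φ (Finset.mem_union_right _ hφ)⟩
    · rintro ⟨h₁, h₂⟩ φ hφ
      rcases Finset.mem_union.1 hφ with h | h
      · obtain ⟨ψ, hψ, rfl⟩ := Finset.mem_image.1 h
        exact h₁ ψ hψ
      · exact h₂ φ h
  -- `s` defines the intersection. Forms vanishing at the generic `y` vanish on all of it, so the
  -- faces cut out by the forms active at `y` contain it and have `y` in their relative interiors.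
  obtain ⟨y, hy, hgen⟩ := exists_generic_point s
  obtain ⟨hy₁, hy₂⟩ := hs.1 hy
  refine ⟨s₁.filter fun φ => φ (γ.symm y) = 0, Finset.filter_subset _ _,
    s₂.filter fun φ => φ y = 0, Finset.filter_subset _ _, Subset.antisymm ?_ ?_,
    y, ⟨γ.symm y, mem_intrinsicInterior_dualConeFace ⟨hy₁, ?_⟩ ?_, γ.apply_symm_apply y⟩,
    mem_intrinsicInterior_dualConeFace ⟨hy₂, ?_⟩ ?_⟩
  · rintro _ ⟨⟨z, hz, rfl⟩, hz₂⟩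
    have hzs : γ z ∈ dualCone s := hs.2 ⟨by simpa using hz, hz₂⟩
    refine ⟨⟨z, ⟨hz, fun φ hφ => ?_⟩, rfl⟩, hz₂, fun φ hφ => ?_⟩
    · obtain ⟨hφ, h0⟩ := Finset.mem_filter.1 hφ
      simpa using hgen (φ ∘ₗ (γ.symm : V →ₗ[ℝ] V))
        (Finset.mem_union_left _ (Finset.mem_image_of_mem _ hφ)) h0 _ hzs
    · obtain ⟨hφ, h0⟩ := Finset.mem_filter.1 hφ
      exact hgen φ (Finset.mem_union_right _ hφ) h0 _ hzs
  · exact inter_subset_inter (image_mono fun z hz => hz.1) fun z hz => hz.1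
  · exact fun φ hφ => (Finset.mem_filter.1 hφ).2
  · exact fun φ hφ h => Finset.mem_filter.2 ⟨hφ, h⟩
  · exact fun φ hφ => (Finset.mem_filter.1 hφ).2
  · exact fun φ hφ h => Finset.mem_filter.2 ⟨hφ, h⟩

theorem finite_intersections [Module ℚ V] {VQ : Submodule ℚ V}
    (hC_convex : Convex ℝ C) (hC_cone : IsCone C)
    (hL : ∃ _ : DiscreteTopology L, IsZLattice ℝ L)
    (hLQ : ∀ v ∈ VQ, ∃ n : ℕ, 0 < n ∧ (n : ℝ) • v ∈ L)
    {ξ : V →ₗ[ℝ] ℝ} (hξL : ∀ v ∈ L, ∃ m : ℤ, ξ v = m) (hξC : ∀ x ∈ closure C, ‖x‖ ≤ ξ x)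
    {Γ : Subgroup (V ≃ₗ[ℝ] V)} (hΓL : ∀ γ : Γ, γ • (L : Set V) = L)
    (hΓX : ∀ γ : Γ, γ • rationalHull VQ C = rationalHull VQ C)
    {s₁ s₂ : Finset (V →ₗ[ℝ] ℝ)} (h₁ : dualCone s₁ ⊆ rationalHull VQ C)
    (h₂ : dualCone s₂ ⊆ rationalHull VQ C) :
    (Set.range fun γ : Γ => γ • dualCone s₁ ∩ dualCone s₂).Finite := by
  classical
  let R : Finset (V →ₗ[ℝ] ℝ) → Finset (V →ₗ[ℝ] ℝ) → Set (Set V) := fun I J =>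
    (fun γ : Γ => γ • dualConeFace s₁ I ∩ dualConeFace s₂ J) '' {γ : Γ |
      (γ • intrinsicInterior ℝ (dualConeFace s₁ I) ∩
        intrinsicInterior ℝ (dualConeFace s₂ J)).Nonempty}
  have hR : ∀ I J, (R I J).Finite := by
    intro I J
    have hI : dualConeFace s₁ I ⊆ rationalHull VQ C := fun x hx => h₁ hx.1
    have hJ : dualConeFace s₂ J ⊆ rationalHull VQ C := fun x hx => h₂ hx.1
    simp only [R]
    obtain ⟨t₁, ht₁⟩ := exists_dualConeFace_eq s₁ I
    obtain ⟨t₂, ht₂⟩ := exists_dualConeFace_eq s₂ J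
    rw [ht₁] at hI ⊢
    rw [ht₂] at hJ ⊢
    obtain ⟨x₁, hx₁⟩ :=
      Set.Nonempty.intrinsicInterior (convex_dualCone t₁) ⟨0, zero_mem_dualCone t₁⟩
    obtain ⟨x₂, hx₂⟩ :=
      Set.Nonempty.intrinsicInterior (convex_dualCone t₂) ⟨0, zero_mem_dualCone t₂⟩
    have hF₁ := isCarrierFace_minFace (convex_convexHull ℝ _) hI hx₁
    have hF₂ := isCarrierFace_minFace (convex_convexHull ℝ _) hJ hx₂
    obtain ⟨T, hT, hTeq⟩ := exists_finite_left_cosets hC_convex hC_cone hL hLQ hξL hξC hΓL hΓX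
      hI hJ hF₁ hF₂
    rw [hTeq]
    refine (hT.image fun γ : Γ => γ • dualCone t₁ ∩ dualCone t₂).subset ?_
    rintro _ ⟨_, ⟨t, ht, z, hz, rfl⟩, rfl⟩
    refine ⟨t, ht, ?_⟩
    -- `z` fixes the carrier face pointwise, so the intersection depends only on the coset
    -- representative `t`.
    have hfix : z • dualCone t₁ = dualCone t₁ := by
      have hz' := (mem_fixingSubgroup_iff Γ).1 hz
      have hsub := hF₁.subset hI hx₁
      refine Subset.antisymm ?_ fun x hx => ⟨x, hx, hz' x (hsub hx)⟩
      rintro _ ⟨x, hx, rfl⟩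
      change z • x ∈ dualCone t₁
      rwa [hz' x (hsub hx)]
    simp only
    rw [mul_smul, hfix]
  refine (s₁.powerset.finite_toSet.biUnion fun I _ =>
    s₂.powerset.finite_toSet.biUnion fun J _ => hR I J).subset ?_
  rintro _ ⟨γ, rfl⟩
  obtain ⟨I, hI, J, hJ, heq, hne⟩ := exists_faces_inter_eq (γ : V ≃ₗ[ℝ] V) s₁ s₂
  refine mem_biUnion (x := I) (Finset.mem_coe.2 (Finset.mem_powerset.2 hI))
    (mem_biUnion (x := J) (Finset.mem_coe.2 (Finset.mem_powerset.2 hJ)) ⟨γ, hne, heq.symm⟩)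

theorem image_rationalHull_subset [Module ℚ V] [IsScalarTower ℚ ℝ V] {VQ : Submodule ℚ V}
    (hLVQ : (L : Set V) ⊆ VQ)
    (hLQ : ∀ v ∈ VQ, ∃ n : ℕ, 0 < n ∧ (n : ℝ) • v ∈ L) (γ : V ≃ₗ[ℝ] V) (hγC : γ '' C = C)
    (hγL : γ '' (L : Set V) = L) : γ '' rationalHull VQ C ⊆ rationalHull VQ C := by
  have himage : γ '' rationalHull VQ C = convexHull ℝ (γ '' (closure C ∩ VQ)) :=
    (γ : V →ₗ[ℝ] V).image_convexHull _
  rw [himage]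
  refine convexHull_mono ?_
  rintro _ ⟨v, ⟨hvC, hvQ⟩, rfl⟩
  constructor
  · have hcont : Continuous γ := (γ : V →ₗ[ℝ] V).continuous_of_finiteDimensional
    exact map_mem_closure hcont hvC fun y hy => hγC ▸ mem_image_of_mem γ hy
  · obtain ⟨n, hn, hnv⟩ := hLQ v hvQ
    have hmem : (n : ℝ) • γ v ∈ VQ := by
      rw [← map_smul]
      exact hLVQ (hγL ▸ mem_image_of_mem γ hnv)
    have hn0 : (n : ℝ) ≠ 0 := Nat.cast_ne_zero.2 hn.ne'
    have := VQ.smul_mem ((n : ℚ)⁻¹) hmem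
    rw [← algebraMap_smul ℝ, smul_smul] at this
    simpa [hn0] using this

/-! ### Proper discontinuity on `C` -/

theorem exists_uniform_inner (hC_open : IsOpen C) (hC_cone : IsCone C)
    (hL : ∃ _ : DiscreteTopology L, IsZLattice ℝ L) {K : Set V} (hKC : K ⊆ C) (hK : IsCompact K) :
    ∃ ε : V → ℝ, (∀ b, 0 < ε b) ∧ ∀ x ∈ K, ∀ b, ∀ ξ : Module.Dual ℝ V,
      (∀ a ∈ closure C ∩ L, 0 ≤ ξ a) → ε b * ξ b ≤ ξ x := by
  obtain ⟨δ, hδ, hthick⟩ := hK.exists_thickening_subset_open hC_open hKC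
  refine ⟨fun b => δ / (‖b‖ + 1), fun b => by positivity, fun x hx b ξ hξ => ?_⟩
  -- The displacement is shorter than `δ`, the uniform distance by which `K` can be thickened inside
  -- `C`.
  have hmem : x - (δ / (‖b‖ + 1)) • b ∈ C := by
    refine hthick (Metric.mem_thickening_iff.2 ⟨x, hx, ?_⟩)
    rw [dist_eq_norm, sub_sub_cancel_left, norm_neg, norm_smul, Real.norm_of_nonneg (by positivity),
      div_mul_eq_mul_div, div_lt_iff₀ (by positivity)]
    nlinarith [norm_nonneg b]
  have := nonneg_on_cone_of_nonneg_on_lattice hC_open hC_cone hL ξ hξ hmem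
  simp only [map_sub, map_smul, smul_eq_mul] at this
  linarith

/-- A minimizer at a point of `K` is bounded there by the maximum of a fixed `ξ₀` on `K`, and
uniform innerness turns this into bounds at every lattice point of the closed cone. -/
theorem finite_minimizers_of_isCompact (hC_open : IsOpen C) (hC_cone : IsCone C)
    (hL : ∃ _ : DiscreteTopology L, IsZLattice ℝ L)
    (hD : (properForms (closure C ∩ L)).Nonempty) {K : Set V} (hKC : K ⊆ C) (hK : IsCompact K) :
    {ξ | ∃ x ∈ K, ξ ∈ minimizers (closure C ∩ L) x}.Finite := by
  obtain ⟨ε, hε, h⟩ := exists_uniform_inner hC_open hC_cone hL hKC hK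
  obtain ⟨ξ₀, hξ₀⟩ := hD
  obtain ⟨M, hM⟩ := hK.bddAbove_image ξ₀.continuous_of_finiteDimensional.continuousOn
  refine (finite_forms_of_bounded (span_closure_inter_lattice hC_open hC_cone hL)
    fun b => M / ε b).subset ?_
  rintro ξ ⟨x, hx, hξ, hmin⟩
  refine ⟨hξ.1, fun b _ => ?_⟩
  rw [le_div_iff₀ (hε b), mul_comm]
  exact (h x hx b ξ (properForms_nonneg hξ)).trans
    ((hmin ξ₀ hξ₀).trans (hM (mem_image_of_mem _ hx)))

theorem actsProperlyDiscontinuouslyOn (hC_open : IsOpen C) (hC_cone : IsCone C)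
    (hL : ∃ _ : DiscreteTopology L, IsZLattice ℝ L)
    (hD : (properForms (closure C ∩ L)).Nonempty)
    {Γ : Subgroup (V ≃ₗ[ℝ] V)} (hΓC : ∀ γ : Γ, γ • C = C) (hΓL : ∀ γ : Γ, γ • (L : Set V) = L) :
    ActsProperlyDiscontinuouslyOn Γ C := by
  intro K₁ K₂ hK₁C hK₂C hK₁ hK₂
  have hspan := span_closure_inter_lattice hC_open hC_cone hL
  have key := finite_isomorphisms hspan hspan hD (X := K₁) (Y := K₂)
    (fun y hy b _ => by
      obtain ⟨ε, hε, h⟩ := exists_uniform_inner hC_open hC_cone hL hK₂C hK₂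
      exact ⟨ε b, hε b, h y hy b⟩)
    (finite_minimizers_of_isCompact hC_open hC_cone hL hD hK₁C hK₁)
    (finite_minimizers_of_isCompact hC_open hC_cone hL hD hK₂C hK₂)
  refine Set.Finite.of_injOn (f := ((↑) : Γ → V ≃ₗ[ℝ] V)) ?_ Subtype.val_injective.injOn key
  rintro γ ⟨_, ⟨x, hx, rfl⟩, hγx⟩
  refine ⟨?_, x, hx, hγx⟩
  have hγC : (γ : V ≃ₗ[ℝ] V) '' C = C := hΓC γ
  have hγL : (γ : V ≃ₗ[ℝ] V) '' (L : Set V) = L := hΓL γ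
  have hcl : (γ : V ≃ₗ[ℝ] V) '' closure C = closure C := by
    have := (γ : V ≃ₗ[ℝ] V).toContinuousLinearEquiv.toHomeomorph.image_closure C
    exact this.trans (congrArg closure hγC)
  rw [image_inter (γ : V ≃ₗ[ℝ] V).injective, hcl, hγL]

end Siegel

end LatticeCone

theorem theorem3 {V : Type*} [NormedAddCommGroup V] [NormedSpace ℝ V] [FiniteDimensional ℝ V]
    [Module ℚ V] [IsScalarTower ℚ ℝ V]
    (VQ : Submodule ℚ V) (hVQ : LatticeCone.IsRationalStructure VQ)
    (C : Set V) (hC_open : IsOpen C) (hC_convex : Convex ℝ C)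
    (hC_cone : LatticeCone.IsCone C) (hC_nondeg : LatticeCone.IsNondegenerate C)
    (Γ : Subgroup (V ≃ₗ[ℝ] V)) (hΓC : ∀ γ : Γ, γ • C = C)
    (hΓL : ∃ L : Submodule ℤ V, LatticeCone.IsRationalLattice VQ L ∧
      ∀ γ : Γ, γ • (L : Set V) = L) :
    -- the Siegel property of `Γ` in `C₊`
    (∀ P₁ P₂ : Set V,
      LatticeCone.IsPolyhedralCone P₁ → LatticeCone.IsPolyhedralCone P₂ →
      P₁ ⊆ LatticeCone.rationalHull VQ C → P₂ ⊆ LatticeCone.rationalHull VQ C →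
      -- the collection of the sets `γ P₁ ∩ P₂` is finite
      (Set.range fun γ : Γ => γ • P₁ ∩ P₂).Finite ∧
      -- the faces `F₁`, `F₂` are well defined
      (∃! F₁ : Set V, LatticeCone.IsCarrierFace (LatticeCone.rationalHull VQ C) P₁ F₁) ∧
      (∃! F₂ : Set V, LatticeCone.IsCarrierFace (LatticeCone.rationalHull VQ C) P₂ F₂) ∧
      ∀ F₁ F₂ : Set V,
        LatticeCone.IsCarrierFace (LatticeCone.rationalHull VQ C) P₁ F₁ →
        LatticeCone.IsCarrierFace (LatticeCone.rationalHull VQ C) P₂ F₂ →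
        -- a finite union of cosets `γ Z_Γ(F₁)`
        (∃ T : Set Γ, T.Finite ∧
          {γ : Γ | (γ • intrinsicInterior ℝ P₁ ∩ intrinsicInterior ℝ P₂).Nonempty} =
            T * (fixingSubgroup Γ F₁ : Set Γ)) ∧
        -- a finite union of cosets `Z_Γ(F₂) γ`
        (∃ T : Set Γ, T.Finite ∧
          {γ : Γ | (γ • intrinsicInterior ℝ P₁ ∩ intrinsicInterior ℝ P₂).Nonempty} =
            (fixingSubgroup Γ F₂ : Set Γ) * T)) ∧
    LatticeCone.ActsProperlyDiscontinuouslyOn Γ C := by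
  obtain ⟨L, hLat, hΓL⟩ := hΓL
  have hLQ : ∀ v ∈ VQ, ∃ n : ℕ, 0 < n ∧ (n : ℝ) • v ∈ L :=
    fun v hv => LatticeCone.exists_smul_mem_lattice hVQ hLat hv
  obtain ⟨hL, hLVQ⟩ := hLat
  obtain ⟨ξ, hξL, hξC⟩ :=
    LatticeCone.exists_integral_coercive_form hC_open hC_convex hC_cone hC_nondeg hL
  have hsub (γ : Γ) : γ • LatticeCone.rationalHull VQ C ⊆ LatticeCone.rationalHull VQ C :=
    LatticeCone.image_rationalHull_subset hLVQ hLQ γ (hΓC γ) (hΓL γ)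
  have hΓX (γ : Γ) : γ • LatticeCone.rationalHull VQ C = LatticeCone.rationalHull VQ C := by
    refine (hsub γ).antisymm ?_
    rw [Set.subset_smul_set_iff]
    exact hsub γ⁻¹
  refine ⟨fun P₁ P₂ hP₁ hP₂ h₁ h₂ => ?_, LatticeCone.actsProperlyDiscontinuouslyOn hC_open hC_cone
    hL ⟨ξ, LatticeCone.mem_properForms_of_coercive hL hξL Set.inter_subset_right
      fun a ha => hξC a ha.1⟩ hΓC hΓL⟩
  obtain ⟨s₁, rfl⟩ := hP₁.exists_eq_dualCone
  obtain ⟨s₂, rfl⟩ := hP₂.exists_eq_dualCone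
  refine ⟨LatticeCone.finite_intersections hC_convex hC_cone hL hLQ hξL hξC hΓL hΓX h₁ h₂,
    LatticeCone.existsUnique_isCarrierFace (convex_convexHull ℝ _) (LatticeCone.convex_dualCone s₁)
      hP₁.1.1 h₁,
    LatticeCone.existsUnique_isCarrierFace (convex_convexHull ℝ _) (LatticeCone.convex_dualCone s₂)
      hP₂.1.1 h₂, fun F₁ F₂ hF₁ hF₂ => ⟨LatticeCone.exists_finite_left_cosets hC_convex hC_cone hL
      hLQ hξL hξC hΓL hΓX h₁ h₂ hF₁ hF₂, ?_⟩⟩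
  obtain ⟨T, hT, hTeq⟩ := LatticeCone.exists_finite_left_cosets hC_convex hC_cone hL
      hLQ hξL hξC hΓL hΓX h₂ h₁ hF₂ hF₁
  -- Inversion exchanges the two cones and turns left cosets of the stabilizer of `F₂` into right
  -- cosets.
  refine ⟨T⁻¹, hT.inv, ?_⟩
  have hinv : {γ : Γ | (γ • intrinsicInterior ℝ (LatticeCone.dualCone s₁) ∩
      intrinsicInterior ℝ (LatticeCone.dualCone s₂)).Nonempty} =
      {γ : Γ | (γ • intrinsicInterior ℝ (LatticeCone.dualCone s₂) ∩
      intrinsicInterior ℝ (LatticeCone.dualCone s₁)).Nonempty}⁻¹ := by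
    ext γ
    simp only [Set.mem_inv, Set.mem_ofPred_eq]
    rw [← Set.smul_set_nonempty (a := γ⁻¹), Set.smul_set_inter, inv_smul_smul, Set.inter_comm]
  rw [hinv, hTeq, mul_inv_rev, inv_coe_set]
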